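/- Let $\mathbb Z_-$ be the set of non-positive integers. All filtrations are non-decreasing sequences $(\mathcal F_n)_{n\in\mathbb Z_-}$ of complete, essentially separable sub-$\sigma$-fields of a probability space. A filtration is \emph{of product type} if it is the completed natural filtration of a sequence $(V_n)_{n\le 0}$ of independent random variables. A filtration $\mathcal F$ is \emph{immersed} in a filtration $\mathcal H$ on the same probability space if, for every $n\le 0$, $\mathcal F_n\subset\mathcal H_n$ and $\mathcal F_n$ is independent of $\mathcal H_{n-1}$ conditionally on $\mathcal F_{n-1}$. An \emph{isomorphism} between filtrations $\mathcal F$ and $\mathcal F'$, on possibly different probability spaces, is a bijection $\Psi:L^0(\mathcal F_0)\to L^0(\mathcal F'_0)$ between the spaces of (classes of) real random variables which preserves laws, commutes with Borel maps $\mathbb R^{\mathbb N}\to\mathbb R$, and is such that for every $n\le0$ the random variables $\Psi(X)$, $X\in L^0(\mathcal F_n)$, generate the complete $\sigma$-field $\mathcal F'_n$. A filtration is \emph{standard} if it is isomorphic to a filtration which is immersed in some product-type filtration. A filtration $\mathcal F$ is \emph{at the threshold of standardness} if it is not standard, but $(\mathcal F_{\psi(n)})_{n\le 0}$ is standard for every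 strictly increasing map $\psi:\mathbb Z_-\to\mathbb Z_-$ whose range omits infinitely many elements of $\mathbb Z_-$. Let $(\mathcal F_n)_{n\le 0}$ be a filtration at the threshold of standardness. Define the strictly increasing map $\phi:\mathbb Z_-\to\mathbb Z_-$ by $\phi(0)=0$, $\phi(-1)=-1$ and, for every integer $k\le -1$, $$\phi(2k)=-2^{|k|},\qquad \phi(2k-1)=-2^{|k|}-1 .$$ Let $\mathcal G$ be the slowed filtration defined, for $n\le 0$, by $\mathcal G_n=\mathcal F_k$, where $k\le 0$ is the unique integer such that $\phi(k-1)+1\le n\le\phi(k)$. Then for every integer $d\ge 1$, the filtration $(\mathcal G_{2^dn})_{n\le 0}$ is not standard, whereas the filtration $(\mathcal G_{2^dn-2^{d-1}})_{n\le 0}$ is standard. -/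

import Mathlib

open MeasureTheory ProbabilityTheory

universe u v

namespace Standardness

/-- The non-positive integers, with the usual order. -/
abbrev NonposInt : Type := {n : ℤ // n ≤ 0}

instance : Zero NonposInt := ⟨⟨0, le_rfl⟩⟩

/-- `n - 1`. -/
def pred (n : NonposInt) : NonposInt := ⟨(n : ℤ) - 1, by have := n.2; omega⟩

/-- The complete σ-field generated by `m` with respect to `P`: all sets which are almost surely equal
to some element of `m`. -/
abbrev completion {Ω : Type u} [MeasurableSpace Ω] (P : Measure Ω) (m : MeasurableSpace Ω) :
    MeasurableSpace Ω :=
  eventuallyMeasurableSpace m (ae P)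

/-- Filtrations indexed by the non-positive integers on the probability space `(Ω, mΩ, P)`:
non-decreasing sequences of sub-σ-fields of `mΩ`, all complete and essentially separable
(generated, as complete σ-fields, by a sequence of events). -/
structure NegFiltration {Ω : Type u} [mΩ : MeasurableSpace Ω] (P : Measure Ω) extends
    Filtration NonposInt mΩ where
  complete : ∀ (n : NonposInt) (s : Set Ω), P s = 0 → MeasurableSet[seq n] s
  separable : ∀ n : NonposInt, ∃ e : ℕ → Set Ω,
    seq n = completion P (MeasurableSpace.generateFrom (Set.range e))

instance {Ω : Type u} [MeasurableSpace Ω] (P : Measure Ω) :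
    CoeFun (NegFiltration P) (fun _ => NonposInt → MeasurableSpace Ω) := ⟨fun F => F.seq⟩

/-- The filtration `(F_{φ(n)})_{n ≤ 0}` extracted from `F` by an increasing map `φ`. -/
def NegFiltration.extract {Ω : Type u} [MeasurableSpace Ω] {P : Measure Ω}
    (F : NegFiltration P) (φ : NonposInt → NonposInt) (hφ : StrictMono φ) : NegFiltration P where
  seq n := F (φ n)
  mono' _ _ h := F.mono' (hφ.monotone h)
  le' n := F.le' (φ n)
  complete n := F.complete (φ n)
  separable n := F.separable (φ n)

/-- `L⁰(Ω, m, P)`: almost sure classes of `m`-measurable real random variables. -/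
def L0 {Ω : Type u} (m : MeasurableSpace Ω) [MeasurableSpace Ω] (P : Measure Ω) :
    Set (Ω →ₘ[P] ℝ) :=
  {X | AEStronglyMeasurable[m] (X : Ω → ℝ) P}

/-- Isomorphism of filtered probability spaces: a bijection `Ψ` from `L⁰(F_∞)` onto `L⁰(F'_∞)` which
preserves laws, commutes with Borel maps `ℝ^ℕ → ℝ` and sends `F` on `F'`, that is, for each `n` the
random variables `Ψ(X)` with `X ∈ L⁰(F_n)` generate the complete σ-field `F'_n`.
Here `F_∞ = F_0` because `0` is the largest index. -/
def IsIsomorphic {Ω : Type u} {Ω' : Type v} [MeasurableSpace Ω] [MeasurableSpace Ω']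
    {P : Measure Ω} {P' : Measure Ω'} (F : NegFiltration P) (F' : NegFiltration P') : Prop :=
  ∃ Ψ : L0 (F 0) P ≃ L0 (F' 0) P',
    (∀ X : L0 (F 0) P, P'.map (Ψ X : Ω' →ₘ[P'] ℝ) = P.map (X : Ω →ₘ[P] ℝ)) ∧
    (∀ (f : (ℕ → ℝ) → ℝ), Measurable f → ∀ (X : ℕ → L0 (F 0) P) (Y : L0 (F 0) P),
      ((Y : Ω →ₘ[P] ℝ) =ᵐ[P] fun ω => f (fun i => (X i : Ω →ₘ[P] ℝ) ω)) →
      ((Ψ Y : Ω' →ₘ[P'] ℝ) =ᵐ[P'] fun ω => f (fun i => (Ψ (X i) : Ω' →ₘ[P'] ℝ) ω))) ∧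
    (∀ n : NonposInt, F' n = completion P'
      (⨆ X : {X : L0 (F 0) P // (X : Ω →ₘ[P] ℝ) ∈ L0 (F n) P},
        MeasurableSpace.comap ((Ψ X.1 : Ω' →ₘ[P'] ℝ) : Ω' → ℝ) Real.measurableSpace))

/-- `m₁` and `m₂` are independent conditionally on `m₀`. -/
def CondIndepFields {Ω : Type u} [MeasurableSpace Ω] (P : Measure Ω)
    (m₀ m₁ m₂ : MeasurableSpace Ω) : Prop :=
  ∀ A B : Set Ω, MeasurableSet[m₁] A → MeasurableSet[m₂] B →
    P⟦A ∩ B | m₀⟧ =ᵐ[P] P⟦A | m₀⟧ * P⟦B | m₀⟧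

/-- `F` is immersed into `G`. -/
def IsImmersed {Ω : Type u} [MeasurableSpace Ω] {P : Measure Ω} (F G : NegFiltration P) : Prop :=
  ∀ n : NonposInt, F n ≤ G n ∧ CondIndepFields P (F (pred n)) (F n) (G (pred n))

/-- `F` is immersible into `G'`. -/
def IsImmersible {Ω : Type u} {Ω' : Type v} [MeasurableSpace Ω] [MeasurableSpace Ω']
    {P : Measure Ω} {P' : Measure Ω'} (F : NegFiltration P) (G' : NegFiltration P') : Prop :=
  ∃ F' : NegFiltration P', IsIsomorphic F F' ∧ IsImmersed F' G'

/-- `F` is of product type: it is the (completed) natural filtration of a process `(V_n)_{n ≤ 0}` of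
independent random variables. The σ-fields being essentially separable, real-valued
random variables are enough. -/
def IsProductType {Ω : Type u} [MeasurableSpace Ω] {P : Measure Ω} (F : NegFiltration P) : Prop :=
  ∃ V : NonposInt → Ω → ℝ, (∀ n, Measurable (V n)) ∧ iIndepFun V P ∧
    ∀ n : NonposInt, F n = completion P
      (⨆ k : Set.Iic n, MeasurableSpace.comap (V k) Real.measurableSpace)

/-- `F` is standard: it is immersible into a product-type filtration on some probability space. -/
def IsStandard {Ω : Type u} [MeasurableSpace Ω] {P : Measure Ω} (F : NegFiltration P) : Prop :=
  ∃ (Ω' : Type u) (_ : MeasurableSpace Ω') (P' : Measure Ω') (_ : IsProbabilityMeasure P')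
    (H : NegFiltration P'), IsProductType H ∧ IsImmersible F H

/-- `F` is at the threshold of standardness: it is not standard, but every extracted filtration
`(F_{φ(n)})_{n ≤ 0}` such that `φ` skips infinitely many integers is standard. -/
def IsAtThreshold {Ω : Type u} [MeasurableSpace Ω] {P : Measure Ω} (F : NegFiltration P) : Prop :=
  ¬ IsStandard F ∧ ∀ (φ : NonposInt → NonposInt) (hφ : StrictMono φ),
    (Set.range φ)ᶜ.Infinite → IsStandard (F.extract φ hφ)

/-! Slowing down a filtration. -/

theorem le_self_of_strictMono {φ : NonposInt → NonposInt} (hφ : StrictMono φ) (k : NonposInt) :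
    φ k ≤ k := by
  obtain ⟨k, hk⟩ := k
  obtain ⟨j, rfl⟩ : ∃ j : ℕ, k = -(j : ℤ) := ⟨k.natAbs, by omega⟩
  induction j with
  | zero => exact (φ _).2
  | succ j ih =>
    have h1 := ih (by omega)
    have h2 : φ ⟨-((j + 1 : ℕ) : ℤ), hk⟩ < φ ⟨-(j : ℤ), by omega⟩ := hφ (by
      rw [Subtype.mk_lt_mk]; push_cast; omega)
    rw [← Subtype.coe_lt_coe] at h2
    rw [← Subtype.coe_le_coe] at h1 ⊢
    push_cast at h1 h2 ⊢
    omega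

/-- The indices `k ≤ 0` such that `n ≤ φ(k)`. -/
def slowSet (φ : NonposInt → NonposInt) (n : NonposInt) : Set ℤ :=
  {k : ℤ | ∃ h : k ≤ 0, n ≤ φ ⟨k, h⟩}

theorem slowSet_bddBelow {φ : NonposInt → NonposInt} (hφ : StrictMono φ) (n : NonposInt) :
    BddBelow (slowSet φ n) :=
  ⟨n, fun k ⟨h, hk⟩ => Subtype.coe_le_coe.2 (hk.trans (le_self_of_strictMono hφ ⟨k, h⟩))⟩

theorem zero_mem_slowSet {φ : NonposInt → NonposInt} (h0 : φ 0 = 0) (n : NonposInt) :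
    (0 : ℤ) ∈ slowSet φ n :=
  ⟨le_rfl, by
    have : φ ⟨0, le_rfl⟩ = 0 := h0
    rw [this]; exact n.2⟩

/-- The index `k` of the block containing `n`, namely the least `k` with `n ≤ φ(k)`, or equivalently
the only `k` such that `φ(k-1) + 1 ≤ n ≤ φ(k)`. -/
noncomputable def slowIndex (φ : NonposInt → NonposInt) (hφ : StrictMono φ) (h0 : φ 0 = 0)
    (n : NonposInt) : NonposInt :=
  ⟨sInf (slowSet φ n), csInf_le (slowSet_bddBelow hφ n) (zero_mem_slowSet h0 n)⟩

theorem slowIndex_mono {φ : NonposInt → NonposInt} (hφ : StrictMono φ) (h0 : φ 0 = 0) :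
    Monotone (slowIndex φ hφ h0) := fun n m hnm =>
  Subtype.coe_le_coe.1 (csInf_le_csInf (slowSet_bddBelow hφ n) ⟨0, zero_mem_slowSet h0 m⟩
    (fun _ ⟨h, hk⟩ => ⟨h, hnm.trans hk⟩))

theorem slowIndex_eq {φ : NonposInt → NonposInt} (hφ : StrictMono φ) (h0 : φ 0 = 0)
    (n k : NonposInt) (h1 : (φ (pred k) : ℤ) + 1 ≤ n) (h2 : (n : ℤ) ≤ φ k) :
    slowIndex φ hφ h0 n = k := by
  apply Subtype.ext
  apply le_antisymm
  · exact csInf_le (slowSet_bddBelow hφ n) ⟨k.2, h2⟩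
  · refine le_csInf ⟨0, zero_mem_slowSet h0 n⟩ ?_
    rintro j ⟨hj, hnj⟩
    by_contra! hlt
    have h3 : (⟨j, hj⟩ : NonposInt) ≤ pred k := by
      rw [← Subtype.coe_le_coe]; simp only [pred]; omega
    have h4 := hφ.monotone h3
    rw [← Subtype.coe_le_coe] at h4 hnj
    omega

/-- The slowed filtration: `G_n = F_k` if `φ(k-1) + 1 ≤ n ≤ φ(k)`. -/
noncomputable def NegFiltration.slow {Ω : Type u} [MeasurableSpace Ω] {P : Measure Ω}
    (F : NegFiltration P) (φ : NonposInt → NonposInt) (hφ : StrictMono φ) (h0 : φ 0 = 0) :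
    NegFiltration P where
  seq n := F (slowIndex φ hφ h0 n)
  mono' _ _ h := F.mono' (slowIndex_mono hφ h0 h)
  le' _ := F.le' _
  complete _ := F.complete _
  separable _ := F.separable _

theorem NegFiltration.slow_apply {Ω : Type u} [MeasurableSpace Ω] {P : Measure Ω}
    (F : NegFiltration P) (φ : NonposInt → NonposInt) (hφ : StrictMono φ) (h0 : φ 0 = 0)
    (n k : NonposInt) (h1 : (φ (pred k) : ℤ) + 1 ≤ n) (h2 : (n : ℤ) ≤ φ k) :
    F.slow φ hφ h0 n = F k :=
  congrArg F.seq (slowIndex_eq hφ h0 n k h1 h2)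

/-! The time change: `φ(0) = 0`, `φ(-1) = -1` and, for `k ≤ -1`, `φ(2k) = -2^{|k|}` and
`φ(2k-1) = -2^{|k|} - 1`. -/

/-- The values of the time change. -/
def interlinkVal (m : ℤ) : ℤ :=
  if m = 0 then 0
  else if m = -1 then -1
  else if Even m then -(2 : ℤ) ^ (m / 2).natAbs
  else -(2 : ℤ) ^ ((m + 1) / 2).natAbs - 1

theorem interlinkVal_even (k : ℤ) (hk : k ≤ -1) :
    interlinkVal (2 * k) = -(2 : ℤ) ^ k.natAbs := by
  have h : 2 * k / 2 = k := by omega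
  rw [interlinkVal, if_neg (by omega), if_neg (by omega), if_pos (even_two_mul k), h]

theorem interlinkVal_odd (k : ℤ) (hk : k ≤ -1) :
    interlinkVal (2 * k - 1) = -(2 : ℤ) ^ k.natAbs - 1 := by
  have h : (2 * k - 1 + 1) / 2 = k := by omega
  rw [interlinkVal, if_neg (by omega), if_neg (by omega),
    if_neg (by rw [Int.even_iff]; omega), h]

theorem interlinkVal_nonpos (m : ℤ) : interlinkVal m ≤ 0 := by
  have h1 : (0 : ℤ) < 2 ^ (m / 2).natAbs := by positivity
  have h2 : (0 : ℤ) < 2 ^ ((m + 1) / 2).natAbs := by positivity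
  unfold interlinkVal
  split_ifs <;> omega

/-- The time change. -/
def interlinkTime (m : NonposInt) : NonposInt := ⟨interlinkVal m, interlinkVal_nonpos m⟩

theorem interlinkTime_zero : interlinkTime 0 = 0 := rfl

theorem interlinkVal_pred_lt (m : ℤ) (hm : m ≤ 0) : interlinkVal (m - 1) < interlinkVal m := by
  rcases Int.even_or_odd' m with ⟨k, rfl | rfl⟩
  · rcases eq_or_lt_of_le (show k ≤ 0 by omega) with rfl | hk
    · decide
    · rw [interlinkVal_odd k (by omega), interlinkVal_even k (by omega)]; omega
  · rcases eq_or_lt_of_le (show k ≤ -1 by omega) with rfl | hk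
    · decide
    · have e1 : 2 * k + 1 - 1 = 2 * k := by ring
      have e2 : 2 * k + 1 = 2 * (k + 1) - 1 := by ring
      have e3 : k.natAbs = (k + 1).natAbs + 1 := by omega
      rw [e1, interlinkVal_even k (by omega), e2, interlinkVal_odd (k + 1) (by omega), e3, pow_succ]
      have h1 : (2 : ℤ) ^ 1 ≤ 2 ^ (k + 1).natAbs :=
        pow_le_pow_right₀ (by norm_num) (by omega)
      omega

theorem interlinkTime_strictMono : StrictMono interlinkTime := by
  have key : ∀ (j : ℕ) (m : ℤ), m ≤ 0 → interlinkVal (m - (j + 1)) < interlinkVal m := by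
    intro j
    induction j with
    | zero => intro m hm; simpa using interlinkVal_pred_lt m hm
    | succ j ih =>
      intro m hm
      have h1 := ih (m - 1) (by omega)
      have h2 := interlinkVal_pred_lt m hm
      have e : m - ((j + 1 : ℕ) + 1 : ℤ) = m - 1 - (j + 1) := by push_cast; ring
      rw [e]; omega
  intro a b hab
  rw [← Subtype.coe_lt_coe] at hab ⊢
  have h := key ((b : ℤ) - a - 1).toNat b b.2
  have e : (b : ℤ) - ((((b : ℤ) - a - 1).toNat : ℤ) + 1) = a := by omega
  rw [e] at h
  exact h

/-! The extracting maps `n ↦ 2^d n` and `n ↦ 2^d n - 2^{d-1}`. -/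

/-- `n ↦ 2^d n`. -/
def dyadicTime (d : ℕ) (n : NonposInt) : NonposInt :=
  ⟨2 ^ d * (n : ℤ), mul_nonpos_of_nonneg_of_nonpos (by positivity) n.2⟩

theorem dyadicTime_strictMono (d : ℕ) : StrictMono (dyadicTime d) := fun a b hab =>
  Subtype.coe_lt_coe.1 (mul_lt_mul_of_pos_left (Subtype.coe_lt_coe.2 hab) (by positivity))

/-- `n ↦ 2^d n - 2^{d-1}`, used for `d ≥ 1` only. -/
def shiftedDyadicTime (d : ℕ) (n : NonposInt) : NonposInt :=
  ⟨2 ^ d * (n : ℤ) - 2 ^ (d - 1), by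
    have h1 : (2 : ℤ) ^ d * (n : ℤ) ≤ 0 := mul_nonpos_of_nonneg_of_nonpos (by positivity) n.2
    have h2 : (0 : ℤ) < 2 ^ (d - 1) := by positivity
    omega⟩

theorem shiftedDyadicTime_strictMono (d : ℕ) : StrictMono (shiftedDyadicTime d) := fun a b hab =>
  Subtype.coe_lt_coe.1 (sub_lt_sub_right
    (mul_lt_mul_of_pos_left (Subtype.coe_lt_coe.2 hab) (by positivity)) _)

end Standardness

/-!
Slowing down and extracting are both changes of the index, and standardness is stable under every
monotone change of index that is unbounded below: blocks of independent innovations are independent,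
an immersion transfers conditional expectations from any time to any earlier one, and an isomorphism
amounts to an equality in law of sequences of generators.

Conversely, standardness only depends on the tail of the filtration. If `n ↦ F (n - 1)` is
isomorphic to `F'`, immersed in a product-type filtration `H'`, adjoin to the probability space of
`F'` an independent uniform variable `U`. The conditional law of a generator of `F 0` given `F (-1)`
can be simulated as a function of `U` and of the copy of `F (-1)`, and this function prolongs `F'`
to a copy of `F` that remains immersed in `H'` prolonged by the innovation `U`.

In the slowed filtration, `F (-2N)` occupies the single time `-2^N` and `F (-2N - 1)` the times
strictly between `-2^(N + 1)` and `-2^N`. The multiples of `2^d` meet all these blocks as soon as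
`N > d`, so their extraction contains the tail of `F`. The odd multiples of `2^(d - 1)` avoid every
`-2^N` with `N ≥ d`, so their extraction omits infinitely many of the σ-fields `F (-2N)`.
-/

namespace Standardness

namespace NonposInt

theorem le_zero (n : NonposInt) : n ≤ 0 := n.2

/-- The enumeration `0, -1, -2, …` of the non-positive integers. -/
def negNat : ℕ ≃ NonposInt where
  toFun k := ⟨-(k : ℤ), by omega⟩
  invFun n := (n : ℤ).natAbs
  left_inv k := by simp
  right_inv n := Subtype.ext (by have := n.2; dsimp only; omega)

theorem negNat_succ (k : ℕ) : negNat (k + 1) = pred (negNat k) :=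
  Subtype.ext (by simp only [negNat, pred, Equiv.coe_fn_mk]; omega)

theorem negNat_strictAnti : StrictAnti negNat := fun i j hij =>
  Subtype.coe_lt_coe.1 (by simp only [negNat, Equiv.coe_fn_mk]; omega)

theorem negNat_symm_strictAnti : StrictAnti negNat.symm := fun m n hmn => by
  rwa [← negNat_strictAnti.lt_iff_gt, Equiv.apply_symm_apply, Equiv.apply_symm_apply]

@[elab_as_elim]
theorem induction_pred {p : NonposInt → Prop} (zero : p 0) (pred : ∀ n, p n → p (pred n))
    (n : NonposInt) : p n := by
  obtain ⟨k, rfl⟩ := negNat.surjective n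
  induction k with
  | zero => exact zero
  | succ k ih => exact negNat_succ k ▸ pred _ ih

@[elab_as_elim]
theorem cases_pred {p : NonposInt → Prop} (zero : p 0) (pred : ∀ n, p (pred n))
    (n : NonposInt) : p n :=
  induction_pred zero (fun n _ => pred n) n

theorem pred_strictMono : StrictMono pred := fun _ _ hmn => Int.sub_lt_sub_right hmn 1

theorem pred_lt (n : NonposInt) : pred n < n := sub_one_lt (n : ℤ)

theorem le_pred_of_lt {m n : NonposInt} (h : m < n) : m ≤ pred n := Int.le_sub_one_of_lt h

theorem coe_iterate_pred (i : ℕ) (n : NonposInt) : ((pred^[i] n : NonposInt) : ℤ) = n - i := by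
  induction i with
  | zero => simp
  | succ i ih =>
    rw [Function.iterate_succ_apply']
    simp only [pred, ih]
    push_cast
    ring

theorem exists_strictMono_range_eq {S : Set NonposInt} (hS : S.Infinite) :
    ∃ ψ : NonposInt → NonposInt, StrictMono ψ ∧ Set.range ψ = S := by
  have hinf : {k | negNat k ∈ S}.Infinite :=
    hS.preimage (by rw [negNat.surjective.range_eq]; exact Set.subset_univ S)
  refine ⟨negNat ∘ Nat.nth (fun k => negNat k ∈ S) ∘ negNat.symm,
    fun m n hmn => negNat_strictAnti (Nat.nth_strictMono hinf (negNat_symm_strictAnti hmn)), ?_⟩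
  rw [Set.range_comp negNat, negNat.symm.surjective.range_comp, Nat.range_nth_of_infinite hinf]
  exact Set.image_preimage_eq S negNat.surjective

theorem infinite_of_forall_exists_le {S : Set NonposInt} (hS : ∀ m, ∃ n ∈ S, n ≤ m) :
    S.Infinite :=
  Set.infinite_of_forall_exists_lt fun m =>
    let ⟨n, hn, hnm⟩ := hS (pred m)
    ⟨n, hn, hnm.trans_lt (pred_lt m)⟩

end NonposInt

section Snoc

variable {α β : Type*} (x : NonposInt → α) (a : α)

/-- The sequence `…, x (-1), x 0, a`: the sequence `x` moved one step to the past and followed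
by `a`. -/
def snoc (n : NonposInt) : α :=
  if h : n = 0 then a
  else x ⟨n + 1, Int.add_one_le_of_lt (lt_of_le_of_ne n.2 fun h' => h (Subtype.ext h'))⟩

@[simp] theorem snoc_zero : snoc x a 0 = a := dif_pos rfl

@[simp] theorem snoc_pred (n : NonposInt) : snoc x a (pred n) = x n := by
  rw [snoc, dif_neg ((NonposInt.pred_lt n).trans_le n.le_zero).ne]
  exact congrArg x (Subtype.ext (sub_add_cancel (n : ℤ) 1))

theorem forall_snoc {p : α → Prop} : (∀ n, p (snoc x a n)) ↔ p a ∧ ∀ n, p (x n) := by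
  refine ⟨fun h => ⟨snoc_zero x a ▸ h 0, fun n => snoc_pred x a n ▸ h (pred n)⟩, fun h n => ?_⟩
  induction n using NonposInt.cases_pred with
  | zero => exact (snoc_zero x a).symm ▸ h.1
  | pred n => exact (snoc_pred x a n).symm ▸ h.2 n

theorem apply_snoc (f : α → β) (n : NonposInt) :
    f (snoc x a n) = snoc (fun k => f (x k)) (f a) n := by
  induction n using NonposInt.cases_pred <;> simp

theorem iSup_Iic_pred_snoc [CompleteLattice α] (n : NonposInt) :
    ⨆ k : Set.Iic (pred n), snoc x a k = ⨆ k : Set.Iic n, x k := by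
  refine le_antisymm (iSup_le fun ⟨k, hk⟩ => ?_) (iSup_le fun ⟨k, hk⟩ => ?_)
  · induction k using NonposInt.cases_pred with
    | zero => exact absurd hk ((NonposInt.pred_lt n).trans_le n.le_zero).not_ge
    | pred k =>
      rw [snoc_pred]
      exact le_iSup (fun k : Set.Iic n => x k) ⟨k, NonposInt.pred_strictMono.le_iff_le.1 hk⟩
  · exact le_iSup_of_le ⟨pred k, NonposInt.pred_strictMono.monotone hk⟩ (snoc_pred x a k).ge

theorem iSup_Iic_zero_snoc [CompleteLattice α] :
    ⨆ k : Set.Iic (0 : NonposInt), snoc x a k = (⨆ k : Set.Iic (0 : NonposInt), x k) ⊔ a := by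
  refine le_antisymm (iSup_le fun ⟨k, hk⟩ => ?_) (sup_le (iSup_le fun ⟨k, hk⟩ => ?_) ?_)
  · induction k using NonposInt.cases_pred with
    | zero => exact (snoc_zero x a).le.trans le_sup_right
    | pred k =>
      exact (snoc_pred x a k).le.trans (le_sup_of_le_left
        (le_iSup (fun k : Set.Iic (0 : NonposInt) => x k) ⟨k, k.le_zero⟩))
  · exact le_iSup_of_le ⟨pred k, (pred k).le_zero⟩ (snoc_pred x a k).ge
  · exact le_iSup_of_le ⟨0, Set.self_mem_Iic⟩ (snoc_zero x a).ge

end Snoc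

open MeasurableSpace (CountablyGenerated comap generateFrom)

section CountablyGenerated

theorem countablyGenerated_iSup {ι : Sort*} {Ω : Type*} [Countable ι] {m : ι → MeasurableSpace Ω}
    (hm : ∀ i, @CountablyGenerated Ω (m i)) : @CountablyGenerated Ω (⨆ i, m i) := by
  choose b hb hgen using fun i => (hm i).isCountablyGenerated
  refine @CountablyGenerated.mk Ω (⨆ i, m i) ⟨⋃ i, b i, Set.countable_iUnion hb, ?_⟩
  rw [← MeasurableSpace.iSup_generateFrom]
  exact iSup_congr hgen

theorem exists_real_comap_eq {Ω : Type*} {m : MeasurableSpace Ω} (hm : CountablyGenerated Ω) :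
    ∃ f : Ω → ℝ, comap f Real.measurableSpace = m := by
  let e := MeasurableSpace.natGeneratingSequence Ω
  let Y : Ω → ℕ → Prop := fun ω k => ω ∈ e k
  have hE := measurableEmbedding_embeddingReal (ℕ → Prop)
  refine ⟨embeddingReal (ℕ → Prop) ∘ Y, ?_⟩
  rw [← MeasurableSpace.comap_comp, hE.comap_eq]
  refine le_antisymm (Measurable.comap_le ?_) ?_
  · exact measurable_pi_lambda _ fun k =>
      measurableSet_setOfPred.1 (MeasurableSpace.measurableSet_natGeneratingSequence k)
  · conv_lhs => rw [← MeasurableSpace.generateFrom_natGeneratingSequence Ω]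
    refine MeasurableSpace.generateFrom_le ?_
    rintro _ ⟨k, rfl⟩
    exact ⟨{p | p k}, measurableSet_setOfPred.2 (measurable_pi_apply k), rfl⟩

theorem comap_pi_eq_iSup {ι Ω : Type*} {β : ι → Type*} [mβ : ∀ i, MeasurableSpace (β i)]
    (Z : ∀ i, Ω → β i) : comap (fun ω i => Z i ω) MeasurableSpace.pi = ⨆ i, comap (Z i) (mβ i) := by
  simp only [MeasurableSpace.pi, MeasurableSpace.comap_iSup, MeasurableSpace.comap_comp]
  rfl

end CountablyGenerated

section Completion

variable {Ω : Type*} {m m₁ m₂ m₃ : MeasurableSpace Ω} [mΩ : MeasurableSpace Ω] {P : Measure Ω}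

theorem completion_le_completion (h : m₁ ≤ completion P m₂) :
    completion P m₁ ≤ completion P m₂ := by
  rintro s ⟨t, ht, hst⟩
  exact EventuallyMeasurableSet.congr (h t ht) hst

theorem completion_mono (h : m₁ ≤ m₂) : completion P m₁ ≤ completion P m₂ :=
  completion_le_completion (h.trans le_eventuallyMeasurableSpace)

theorem completion_sup_le_completion_sup (h : completion P m₁ = completion P m₂) :
    completion P (m₁ ⊔ m₃) ≤ completion P (m₂ ⊔ m₃) :=
  completion_le_completion (sup_le
    (le_eventuallyMeasurableSpace.trans (h.le.trans (completion_mono le_sup_left)))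
    (le_sup_right.trans le_eventuallyMeasurableSpace))

theorem completion_sup_congr (h : completion P m₁ = completion P m₂) :
    completion P (m₁ ⊔ m₃) = completion P (m₂ ⊔ m₃) :=
  le_antisymm (completion_sup_le_completion_sup h) (completion_sup_le_completion_sup h.symm)

theorem completion_le [P.IsComplete] (hm : m ≤ mΩ) : completion P m ≤ mΩ := by
  rintro s ⟨t, ht, hst⟩
  exact NullMeasurableSet.measurable_of_complete ⟨t, hm t ht, hst⟩

theorem comap_le_completion_comap {α β : Type*} [mα : MeasurableSpace α] [mβ : MeasurableSpace β]
    {f : Ω → α} {g : Ω → β} {h : β → α} (hh : Measurable h) (hf : f =ᵐ[P] h ∘ g) :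
    mα.comap f ≤ completion P (mβ.comap g) := by
  rintro _ ⟨s, hs, rfl⟩
  exact ⟨g ⁻¹' (h ⁻¹' s), ⟨_, hh hs, rfl⟩, hf.preimage s⟩

theorem condExp_completion [IsFiniteMeasure P] [P.IsComplete] (hm : m ≤ mΩ) {f : Ω → ℝ}
    (hf : Integrable f P) : P[f | completion P m] =ᵐ[P] P[f | m] := by
  refine (ae_eq_condExp_of_forall_setIntegral_eq (completion_le hm) hf
    (fun _ _ _ => integrable_condExp.integrableOn) ?_
    (stronglyMeasurable_condExp.mono le_eventuallyMeasurableSpace).aestronglyMeasurable).symm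
  rintro s ⟨t, ht, hst⟩ -
  rw [setIntegral_congr_set hst, setIntegral_condExp hm hf ht, setIntegral_congr_set hst]

-- `f` need not be integrable, so we take the conditional expectation of `arctan ∘ f`.
theorem exists_measurable_ae_eq_of_measurable_completion [IsFiniteMeasure P] [P.IsComplete]
    (hm : m ≤ mΩ) {f : Ω → ℝ} (hf : Measurable[completion P m] f) :
    ∃ g : Ω → ℝ, Measurable[m] g ∧ f =ᵐ[P] g := by
  have hbdd : Measurable[completion P m] fun ω => Real.arctan (f ω) :=
    Real.measurable_arctan.comp hf
  have hint : Integrable (fun ω => Real.arctan (f ω)) P :=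
    Integrable.of_bound (hbdd.mono (completion_le hm) le_rfl).aestronglyMeasurable (Real.pi / 2)
      (ae_of_all _ fun ω => abs_le.2
        ⟨(Real.neg_pi_div_two_lt_arctan _).le, (Real.arctan_lt_pi_div_two _).le⟩)
  have hce := condExp_completion hm hint
  rw [condExp_of_stronglyMeasurable (completion_le hm) hbdd.stronglyMeasurable hint] at hce
  have htan : Measurable Real.tan := by
    rw [funext Real.tan_eq_sin_div_cos]
    exact Real.measurable_sin.div Real.measurable_cos
  refine ⟨Real.tan ∘ P[fun ω => Real.arctan (f ω) | m],
    htan.comp stronglyMeasurable_condExp.measurable, ?_⟩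
  filter_upwards [hce] with ω hω
  rw [Function.comp_apply, ← hω, Real.tan_arctan]

/-- The complete σ-field `m` is generated by the random variable `Z`. -/
def Generates {β : Type*} [mβ : MeasurableSpace β] (P : Measure Ω) (Z : Ω → β)
    (m : MeasurableSpace Ω) : Prop :=
  m = @completion Ω mΩ P (mβ.comap Z)

theorem Generates.comap_le {β : Type*} [mβ : MeasurableSpace β] {Z : Ω → β}
    (hZ : Generates P Z m) : mβ.comap Z ≤ m :=
  hZ ▸ le_eventuallyMeasurableSpace

theorem mem_L0_iff [IsFiniteMeasure P] [P.IsComplete] {β : Type*} [mβ : MeasurableSpace β]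
    {Z : Ω → β} (hm : m ≤ mΩ) (hZ : Generates P Z m) {X : Ω →ₘ[P] ℝ} :
    X ∈ L0 m P ↔ ∃ h : β → ℝ, Measurable h ∧ X =ᵐ[P] h ∘ Z := by
  refine ⟨fun ⟨Y, hY, hXY⟩ => ?_, fun ⟨h, hh, hX⟩ => ⟨h ∘ Z, ?_, hX⟩⟩
  · obtain ⟨g, hg, hYg⟩ := exists_measurable_ae_eq_of_measurable_completion
      (hZ.comap_le.trans hm) (hZ ▸ hY.measurable)
    obtain ⟨h, hh, rfl⟩ := hg.exists_eq_measurable_comp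
    exact ⟨h, hh, hXY.trans hYg⟩
  · exact (hh.comp (measurable_iff_comap_le.2 hZ.comap_le)).stronglyMeasurable

end Completion

namespace NegFiltration

variable {Ω : Type*} [mΩ : MeasurableSpace Ω] {P : Measure Ω}

theorem isComplete (F : NegFiltration P) : P.IsComplete :=
  ⟨fun s hs => F.le' 0 s (F.complete 0 s hs)⟩

variable (F : NegFiltration P)

theorem completion_eq (n : NonposInt) : completion P (F n) = F n := by
  obtain ⟨e, he⟩ := F.separable n
  rw [he]
  exact le_antisymm (completion_le_completion le_rfl) le_eventuallyMeasurableSpace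

theorem exists_generates (n : NonposInt) : ∃ Z : Ω → ℝ, Generates P Z (F n) := by
  obtain ⟨e, he⟩ := F.separable n
  obtain ⟨Z, hZ⟩ := exists_real_comap_eq
    (@CountablyGenerated.mk Ω (generateFrom (Set.range e)) ⟨_, Set.countable_range e, rfl⟩)
  exact ⟨Z, by rw [Generates, hZ, he]⟩

/-- `F` is the completed natural filtration of the sequence of σ-fields `m`. -/
def IsGeneratedBy (m : NonposInt → MeasurableSpace Ω) : Prop :=
  ∀ n, F n = completion P (⨆ k : Set.Iic n, m k)

variable {F}

theorem IsGeneratedBy.of_generates {β : NonposInt → Type*} [mβ : ∀ n, MeasurableSpace (β n)]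
    {Z : ∀ n, Ω → β n} (hZ : ∀ n, Generates P (Z n) (F n)) :
    F.IsGeneratedBy fun n => (mβ n).comap (Z n) := fun n => by
  refine le_antisymm ?_ ?_
  · rw [show F n = _ from hZ n]
    exact completion_mono (le_iSup (fun k : Set.Iic n => (mβ k).comap (Z k)) ⟨n, Set.self_mem_Iic⟩)
  · rw [← F.completion_eq n]
    exact completion_mono (iSup_le fun k => (hZ k).comap_le.trans (F.mono' k.2))

theorem IsGeneratedBy.le {m : NonposInt → MeasurableSpace Ω} (hF : F.IsGeneratedBy m)
    {k n : NonposInt} (hkn : k ≤ n) : m k ≤ F n :=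
  (le_iSup (fun k : Set.Iic n => m k) ⟨k, hkn⟩).trans
    (le_eventuallyMeasurableSpace.trans (hF n).ge)

theorem IsGeneratedBy.generates_restrict {β : NonposInt → Type*} [mβ : ∀ n, MeasurableSpace (β n)]
    {Z : ∀ n, Ω → β n} (hF : F.IsGeneratedBy fun n => (mβ n).comap (Z n)) (n : NonposInt) :
    Generates P (fun ω (k : Set.Iic n) => Z k ω) (F n) := by
  rw [Generates, comap_pi_eq_iSup, hF n]

end NegFiltration

section Isomorphism

variable {Ω : Type u} {Ω' : Type v} {m : MeasurableSpace Ω} {m' : MeasurableSpace Ω'}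
  [mΩ : MeasurableSpace Ω] [mΩ' : MeasurableSpace Ω'] {P : Measure Ω} {P' : Measure Ω'}

theorem map_eq_map_of_forall_map_comp_eq {α : Type*} [MeasurableSpace α] {Z : Ω → α} {Z' : Ω' → α}
    (hZ : Measurable Z) (hZ' : Measurable Z')
    (h : ∀ f : α → ℝ, Measurable f → P.map (f ∘ Z) = P'.map (f ∘ Z')) : P.map Z = P'.map Z' := by
  ext s hs
  have hf : Measurable (s.indicator fun _ => (1 : ℝ)) := measurable_const.indicator hs
  have hpre : s.indicator (fun _ => (1 : ℝ)) ⁻¹' {1} = s := by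
    ext a
    by_cases ha : a ∈ s <;> simp [ha]
  have hval := congrArg (· {(1 : ℝ)}) (h _ hf)
  simpa only [Measure.map_apply (hf.comp hZ) (measurableSet_singleton (1 : ℝ)),
    Measure.map_apply (hf.comp hZ') (measurableSet_singleton (1 : ℝ)), Set.preimage_comp, hpre,
    Measure.map_apply hZ hs, Measure.map_apply hZ' hs] using hval

/-- The class in `L⁰(F n)` of an `F n`-measurable real random variable, viewed in `L⁰(F 0)`. -/
def NegFiltration.toL0 (F : NegFiltration P) {n : NonposInt} {X : Ω → ℝ}
    (hX : Measurable[F n] X) : L0 (F 0) P :=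
  ⟨AEEqFun.mk X (hX.mono (F.le' n) le_rfl).aestronglyMeasurable, X,
    (hX.mono (F.mono' n.le_zero) le_rfl).stronglyMeasurable, AEEqFun.coeFn_mk _ _⟩

theorem NegFiltration.coeFn_toL0 (F : NegFiltration P) {n : NonposInt} {X : Ω → ℝ}
    (hX : Measurable[F n] X) : (F.toL0 hX : Ω →ₘ[P] ℝ) =ᵐ[P] X := AEEqFun.coeFn_mk _ _

theorem NegFiltration.toL0_mem (F : NegFiltration P) {n : NonposInt} {X : Ω → ℝ}
    (hX : Measurable[F n] X) : (F.toL0 hX : Ω →ₘ[P] ℝ) ∈ L0 (F n) P :=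
  ⟨X, hX.stronglyMeasurable, F.coeFn_toL0 hX⟩

theorem IsIsomorphic.exists_generators [IsFiniteMeasure P] {F : NegFiltration P}
    {F' : NegFiltration P'} (h : IsIsomorphic F F') :
    ∃ (Z : NonposInt → Ω → ℝ) (Z' : NonposInt → Ω' → ℝ),
      (∀ n, Generates P (Z n) (F n)) ∧ (∀ n, Generates P' (Z' n) (F' n)) ∧
      P.map (fun ω n => Z n ω) = P'.map (fun ω n => Z' n ω) := by
  obtain ⟨Ψ, hlaw, hcomm, hgen⟩ := h
  have := F.isComplete
  choose Z hZ using F.exists_generates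
  have hZF : ∀ n, Measurable[F n] (Z n) := fun n => measurable_iff_comap_le.2 (hZ n).comap_le
  let X : NonposInt → L0 (F 0) P := fun n => F.toL0 (hZF n)
  let Z' : NonposInt → Ω' → ℝ := fun n => (Ψ (X n) : Ω' →ₘ[P'] ℝ)
  have hΨ : ∀ (f : (NonposInt → ℝ) → ℝ), Measurable f → ∀ Y : L0 (F 0) P,
      ((Y : Ω →ₘ[P] ℝ) =ᵐ[P] fun ω => f fun n => Z n ω) →
      ((Ψ Y : Ω' →ₘ[P'] ℝ) =ᵐ[P'] fun ω => f fun n => Z' n ω) := by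
    intro f hf Y hY
    have hf' : Measurable fun x : ℕ → ℝ => f fun n => x (NonposInt.negNat.symm n) :=
      hf.comp (measurable_pi_lambda _ fun n => measurable_pi_apply _)
    have hX := ae_all_iff.2 fun n => F.coeFn_toL0 (hZF n)
    simpa only [Equiv.apply_symm_apply] using hcomm _ hf' (fun i => X (NonposInt.negNat i)) Y (by
      filter_upwards [hY, hX] with ω hω hXω
      simp only [hω, X, hXω, Equiv.apply_symm_apply])
  refine ⟨Z, Z', hZ, fun n => ?_, map_eq_map_of_forall_map_comp_eq
    (measurable_pi_lambda _ fun n => (hZF n).mono (F.le' n) le_rfl)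
    (measurable_pi_lambda _ fun n => (AEEqFun.stronglyMeasurable _).measurable) fun f hf => ?_⟩
  · rw [Generates, hgen n]
    refine le_antisymm (completion_le_completion (iSup_le fun Y => ?_)) (completion_mono
      (le_iSup_of_le ⟨X n, F.toL0_mem (hZF n)⟩ le_rfl))
    obtain ⟨g, hg, hY⟩ := (mem_L0_iff (F.le' n) (hZ n)).1 Y.2
    exact comap_le_completion_comap hg
      (hΨ (fun x => g (x n)) (hg.comp (measurable_pi_apply n)) Y.1 hY)
  · have hfZ : Measurable[F 0] fun ω => f fun n => Z n ω :=
      hf.comp (@measurable_pi_lambda _ _ _ (F 0) _ _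
        fun n => (hZF n).mono (F.mono' n.le_zero) le_rfl)
    have hmap := hlaw (F.toL0 hfZ)
    rw [Measure.map_congr (F.coeFn_toL0 hfZ),
      Measure.map_congr (hΨ f hf _ (F.coeFn_toL0 hfZ))] at hmap
    exact hmap.symm

section Transfer

variable {E : Type*} [MeasurableSpace E] {Z : Ω → E} {Z' : Ω' → E}

theorem bijOn_compMeasurePreserving [IsFiniteMeasure P] [P.IsComplete] (hm : m ≤ mΩ)
    (hZ : Generates P Z m) {μ : Measure E} (hp : MeasurePreserving Z P μ) :
    Set.BijOn (fun g : E →ₘ[μ] ℝ => g.compMeasurePreserving Z hp) Set.univ (L0 m P) := by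
  refine ⟨fun g _ => (mem_L0_iff hm hZ).2 ⟨g, (AEEqFun.stronglyMeasurable g).measurable,
    AEEqFun.coeFn_compMeasurePreserving g hp⟩, fun g _ g' _ hgg' => ?_, fun X hX => ?_⟩
  · have hcomp : (g : E → ℝ) ∘ Z =ᵐ[P] g' ∘ Z :=
      (AEEqFun.coeFn_compMeasurePreserving g hp).symm.trans
        ((AEEqFun.ext_iff.1 hgg').trans (AEEqFun.coeFn_compMeasurePreserving g' hp))
    have hae : ∀ᵐ x ∂P.map Z, g x = g' x := (ae_map_iff hp.aemeasurable (measurableSet_eq_fun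
      (AEEqFun.stronglyMeasurable g).measurable (AEEqFun.stronglyMeasurable g').measurable)).2 hcomp
    exact AEEqFun.ext (hp.map_eq ▸ hae)
  · obtain ⟨h, hh, hXh⟩ := (mem_L0_iff hm hZ).1 hX
    refine ⟨AEEqFun.mk h hh.aestronglyMeasurable, trivial, AEEqFun.ext ?_⟩
    exact (AEEqFun.coeFn_compMeasurePreserving _ hp).trans
      ((hp.quasiMeasurePreserving.ae_eq_comp (AEEqFun.coeFn_mk h _)).trans hXh.symm)

theorem exists_L0_equiv [IsFiniteMeasure P] [P.IsComplete] [IsFiniteMeasure P'] [P'.IsComplete]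
    (hm : m ≤ mΩ) (hm' : m' ≤ mΩ') (hZ : Generates P Z m) (hZ' : Generates P' Z' m')
    (h : P.map Z = P'.map Z') :
    ∃ Ψ : L0 m P ≃ L0 m' P', ∀ (X : L0 m P) (g : E → ℝ), Measurable g →
      (X : Ω →ₘ[P] ℝ) =ᵐ[P] g ∘ Z → (Ψ X : Ω' →ₘ[P'] ℝ) =ᵐ[P'] g ∘ Z' := by
  have hp : MeasurePreserving Z P (P.map Z) :=
    ⟨measurable_iff_comap_le.2 (hZ.comap_le.trans hm), rfl⟩
  have hp' : MeasurePreserving Z' P' (P.map Z) :=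
    ⟨measurable_iff_comap_le.2 (hZ'.comap_le.trans hm'), h.symm⟩
  let Φ := (bijOn_compMeasurePreserving hm hZ hp).equiv
  let Φ' := (bijOn_compMeasurePreserving hm' hZ' hp').equiv
  refine ⟨Φ.symm.trans Φ', fun X g hg hX => ?_⟩
  have hΦ : Φ ⟨AEEqFun.mk g hg.aestronglyMeasurable, trivial⟩ = X :=
    Subtype.ext (AEEqFun.ext ((AEEqFun.coeFn_compMeasurePreserving _ hp).trans
      ((hp.quasiMeasurePreserving.ae_eq_comp (AEEqFun.coeFn_mk g _)).trans hX.symm)))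
  rw [← hΦ, Equiv.trans_apply, Equiv.symm_apply_apply]
  exact (AEEqFun.coeFn_compMeasurePreserving _ hp').trans
    (hp'.quasiMeasurePreserving.ae_eq_comp (AEEqFun.coeFn_mk g _))

variable {Ψ : L0 m P → L0 m' P'} (hΨ : ∀ (X : L0 m P) (g : E → ℝ), Measurable g →
  (X : Ω →ₘ[P] ℝ) =ᵐ[P] g ∘ Z → (Ψ X : Ω' →ₘ[P'] ℝ) =ᵐ[P'] g ∘ Z')

include hΨ

theorem map_eq_of_forall_ae_eq_comp [IsFiniteMeasure P] [P.IsComplete] (hm : m ≤ mΩ)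
    (hZ : Generates P Z m) (hZ' : Measurable Z') (h : P.map Z = P'.map Z') (X : L0 m P) :
    P'.map (Ψ X : Ω' →ₘ[P'] ℝ) = P.map (X : Ω →ₘ[P] ℝ) := by
  have hZm : Measurable Z := measurable_iff_comap_le.2 (hZ.comap_le.trans hm)
  obtain ⟨g, hg, hX⟩ := (mem_L0_iff hm hZ).1 X.2
  rw [Measure.map_congr hX, Measure.map_congr (hΨ X g hg hX), ← Measure.map_map hg hZm, h,
    Measure.map_map hg hZ']

theorem ae_eq_comp_of_forall_ae_eq_comp [IsFiniteMeasure P] [P.IsComplete] (hm : m ≤ mΩ)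
    (hZ : Generates P Z m) {f : (ℕ → ℝ) → ℝ} (hf : Measurable f) {X : ℕ → L0 m P} {Y : L0 m P}
    (hY : (Y : Ω →ₘ[P] ℝ) =ᵐ[P] fun ω => f fun i => (X i : Ω →ₘ[P] ℝ) ω) :
    (Ψ Y : Ω' →ₘ[P'] ℝ) =ᵐ[P'] fun ω => f fun i => (Ψ (X i) : Ω' →ₘ[P'] ℝ) ω := by
  choose g hg hX using fun i => (mem_L0_iff hm hZ).1 (X i).2
  have hΨY := hΨ Y (fun x => f fun i => g i x) (hf.comp (measurable_pi_lambda _ hg)) (by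
    filter_upwards [hY, ae_all_iff.2 hX] with ω hω hXω
    simp only [hω, hXω, Function.comp_apply])
  filter_upwards [hΨY, ae_all_iff.2 fun i => hΨ _ _ (hg i) (hX i)] with ω hω hXω
  simp only [hω, hXω, Function.comp_apply]

end Transfer

theorem isIsomorphic_of_map_eq_map [IsFiniteMeasure P] [IsFiniteMeasure P']
    {F : NegFiltration P} {F' : NegFiltration P'} {Z : NonposInt → Ω → ℝ}
    {Z' : NonposInt → Ω' → ℝ} (hF : F.IsGeneratedBy fun n => comap (Z n) Real.measurableSpace)
    (hF' : F'.IsGeneratedBy fun n => comap (Z' n) Real.measurableSpace)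
    (h : P.map (fun ω n => Z n ω) = P'.map (fun ω n => Z' n ω)) : IsIsomorphic F F' := by
  have := F.isComplete
  have := F'.isComplete
  have hZ : ∀ {k n}, k ≤ n → Measurable[F n] (Z k) := fun hkn =>
    measurable_iff_comap_le.2 (hF.le hkn)
  have hZ' : ∀ n, Measurable (Z' n) := fun n =>
    measurable_iff_comap_le.2 ((hF'.le le_rfl).trans (F'.le' n))
  let r : (NonposInt → ℝ) → Set.Iic (0 : NonposInt) → ℝ := fun z k => z k
  have hr : Measurable r := measurable_pi_lambda _ fun k => measurable_pi_apply _
  have hlaw : P.map (fun ω (k : Set.Iic (0 : NonposInt)) => Z k ω) =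
      P'.map (fun ω (k : Set.Iic (0 : NonposInt)) => Z' k ω) := by
    have hmap := congrArg (Measure.map r) h
    rwa [Measure.map_map hr (measurable_pi_lambda _ fun n => (hZ le_rfl).mono (F.le' n) le_rfl),
      Measure.map_map hr (measurable_pi_lambda _ hZ')] at hmap
  have hgen := hF.generates_restrict 0
  obtain ⟨Ψ, hΨ⟩ := exists_L0_equiv (F.le' 0) (F'.le' 0) hgen (hF'.generates_restrict 0) hlaw
  refine ⟨Ψ, map_eq_of_forall_ae_eq_comp hΨ (F.le' 0) hgen
    (measurable_pi_lambda _ fun k => hZ' k) hlaw, fun f hf X Y =>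
    ae_eq_comp_of_forall_ae_eq_comp hΨ (F.le' 0) hgen hf, fun n => ?_⟩
  refine le_antisymm ?_ ?_
  · rw [hF' n]
    refine completion_le_completion (iSup_le fun k => ?_)
    have hΨZ := hΨ (F.toL0 (hZ k.2)) (fun x => x ⟨k, k.1.le_zero⟩) (measurable_pi_apply _)
      (F.coeFn_toL0 (hZ k.2))
    exact (comap_le_completion_comap measurable_id hΨZ.symm).trans (completion_mono
      (le_iSup_of_le ⟨F.toL0 (hZ k.2), F.toL0_mem (hZ k.2)⟩ le_rfl))
  · rw [show F' n = _ from hF'.generates_restrict n]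
    refine completion_le_completion (iSup_le fun Y => ?_)
    obtain ⟨g, hg, hY⟩ := (mem_L0_iff (F.le' n) (hF.generates_restrict n)).1 Y.2
    exact comap_le_completion_comap hg (hΨ Y.1 (fun x => g fun k => x ⟨k, k.1.le_zero⟩)
      (hg.comp (measurable_pi_lambda _ fun k => measurable_pi_apply _)) hY)

end Isomorphism

section ConditionalIndependence

theorem sup_eq_generateFrom_inter {Ω : Type*} {m₁ m₂ : MeasurableSpace Ω} : m₁ ⊔ m₂ =
    generateFrom {s | ∃ A C, MeasurableSet[m₁] A ∧ MeasurableSet[m₂] C ∧ s = A ∩ C} := by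
  refine le_antisymm (sup_le (fun A hA => ?_) fun C hC => ?_) (MeasurableSpace.generateFrom_le ?_)
  · exact MeasurableSpace.measurableSet_generateFrom
      ⟨A, Set.univ, hA, @MeasurableSet.univ _ m₂, (Set.inter_univ A).symm⟩
  · exact MeasurableSpace.measurableSet_generateFrom
      ⟨Set.univ, C, @MeasurableSet.univ _ m₁, hC, (Set.univ_inter C).symm⟩
  · rintro _ ⟨A, C, hA, hC, rfl⟩
    exact @MeasurableSet.inter _ (m₁ ⊔ m₂) _ _ (le_sup_left (a := m₁) _ hA)
      (le_sup_right (a := m₁) _ hC)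

variable {Ω : Type*} {m m₀ m₁ m₂ : MeasurableSpace Ω} [mΩ : MeasurableSpace Ω] {P : Measure Ω}

theorem condExp_congr_set {A B : Set Ω} (h : A =ᵐ[P] B) : P⟦A | m⟧ =ᵐ[P] P⟦B | m⟧ :=
  condExp_congr_ae (indicator_ae_eq_of_ae_eq_set h)

variable [IsFiniteMeasure P]

theorem integrable_indicator_one {B : Set Ω} (hB : MeasurableSet B) :
    Integrable (B.indicator fun _ => (1 : ℝ)) P :=
  (integrable_const 1).indicator hB

theorem condExp_indicator_condExp {A B : Set Ω} (hA : MeasurableSet A) :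
    P[A.indicator (P⟦B | m⟧) | m] =ᵐ[P] P⟦A | m⟧ * P⟦B | m⟧ := by
  have hmul : A.indicator (P⟦B | m⟧) = (A.indicator fun _ => (1 : ℝ)) * P⟦B | m⟧ := by
    ext ω
    by_cases hω : ω ∈ A <;> simp [hω]
  rw [hmul]
  exact condExp_mul_of_stronglyMeasurable_right stronglyMeasurable_condExp
    (hmul ▸ integrable_condExp.indicator hA) (integrable_indicator_one hA)

theorem condIndepFields_iff_condExp_eq (h01 : m₀ ≤ m₁) (h1 : m₁ ≤ mΩ) (h2 : m₂ ≤ mΩ) :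
    CondIndepFields P m₀ m₁ m₂ ↔ ∀ B, MeasurableSet[m₂] B → P⟦B | m₁⟧ =ᵐ[P] P⟦B | m₀⟧ := by
  refine ⟨fun h B hB => (ae_eq_condExp_of_forall_setIntegral_eq h1
    (integrable_indicator_one (h2 _ hB)) (fun _ _ _ => integrable_condExp.integrableOn)
    (fun A hA _ => ?_) (stronglyMeasurable_condExp.mono h01).aestronglyMeasurable).symm,
    fun h A B hA hB => ?_⟩
  · calc ∫ ω in A, (P⟦B | m₀⟧) ω ∂P = ∫ ω, (P[A.indicator (P⟦B | m₀⟧) | m₀]) ω ∂P := by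
          rw [integral_condExp (h01.trans h1), integral_indicator (h1 _ hA)]
      _ = ∫ ω, (P⟦A ∩ B | m₀⟧) ω ∂P :=
          integral_congr_ae ((condExp_indicator_condExp (h1 _ hA)).trans (h A B hA hB).symm)
      _ = ∫ ω in A, (B.indicator fun _ => (1 : ℝ)) ω ∂P := by
          rw [integral_condExp (h01.trans h1), ← Set.indicator_indicator,
            integral_indicator (h1 _ hA)]
  · calc P⟦A ∩ B | m₀⟧ =ᵐ[P] P[P⟦A ∩ B | m₁⟧ | m₀] := (condExp_condExp_of_le h01 h1).symm
      _ =ᵐ[P] P[A.indicator (P⟦B | m₀⟧) | m₀] := by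
          refine condExp_congr_ae ?_
          rw [← Set.indicator_indicator]
          exact (condExp_indicator (integrable_indicator_one (h2 _ hB)) hA).trans
            ((h B hB).mono fun ω hω => by simp only [Set.indicator, hω])
      _ =ᵐ[P] P⟦A | m₀⟧ * P⟦B | m₀⟧ := condExp_indicator_condExp (h1 _ hA)

theorem condExp_eq_of_le_of_le (h01 : m₀ ≤ m₁) (h12 : m₁ ≤ m₂) (h2 : m₂ ≤ mΩ) {f : Ω → ℝ}
    (h : P[f | m₂] =ᵐ[P] P[f | m₀]) : P[f | m₁] =ᵐ[P] P[f | m₀] :=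
  calc P[f | m₁] =ᵐ[P] P[P[f | m₂] | m₁] := (condExp_condExp_of_le h12 h2).symm
    _ =ᵐ[P] P[P[f | m₀] | m₁] := condExp_congr_ae h
    _ = P[f | m₀] := condExp_of_stronglyMeasurable (h12.trans h2)
        (stronglyMeasurable_condExp.mono h01) integrable_condExp

theorem setIntegral_inter_of_indep {A C : Set Ω} (h1 : m₁ ≤ mΩ) (h2 : m₂ ≤ mΩ)
    (h : Indep m₁ m₂ P) {f : Ω → ℝ} (hf : StronglyMeasurable[m₁] f) (hfi : Integrable f P)
    (hA : MeasurableSet[m₁] A) (hC : MeasurableSet[m₂] C) :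
    ∫ ω in A ∩ C, f ω ∂P = P.real C * ∫ ω in A, f ω ∂P :=
  calc ∫ ω in A ∩ C, f ω ∂P = ∫ ω in C, (P[A.indicator f | m₂]) ω ∂P := by
        rw [Set.inter_comm, ← setIntegral_indicator (h1 _ hA),
          setIntegral_condExp h2 (hfi.indicator (h1 _ hA)) hC]
    _ = ∫ _ in C, P[A.indicator f] ∂P := setIntegral_congr_ae (h2 _ hC)
        ((condExp_indep_eq h1 h2 (hf.indicator hA) h).mono fun _ hω _ => hω)
    _ = P.real C * ∫ ω in A, f ω ∂P := by
        rw [setIntegral_const, integral_indicator (h1 _ hA), smul_eq_mul]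

theorem condExp_sup_of_indep (h01 : m₀ ≤ m₁) (h1 : m₁ ≤ mΩ) (h2 : m₂ ≤ mΩ)
    (h : Indep m₁ m₂ P) {f : Ω → ℝ} (hf : StronglyMeasurable[m₁] f) (hfi : Integrable f P) :
    P[f | m₀ ⊔ m₂] =ᵐ[P] P[f | m₀] := by
  have h0 := h01.trans h1
  have hle : m₀ ⊔ m₂ ≤ mΩ := sup_le h0 h2
  refine (ae_eq_condExp_of_forall_setIntegral_eq hle hfi
    (fun _ _ _ => integrable_condExp.integrableOn) (fun s hs _ => ?_)
    (stronglyMeasurable_condExp.mono (le_sup_left : m₀ ≤ m₀ ⊔ m₂)).aestronglyMeasurable).symm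
  induction s, hs using MeasurableSpace.induction_on_inter sup_eq_generateFrom_inter with
  | h_inter =>
    rintro _ ⟨A, C, hA, hC, rfl⟩ _ ⟨A', C', hA', hC', rfl⟩ -
    exact ⟨A ∩ A', C ∩ C', hA.inter hA', hC.inter hC', Set.inter_inter_inter_comm _ _ _ _⟩
  | empty => simp only [setIntegral_empty]
  | basic t ht =>
    obtain ⟨A, C, hA, hC, rfl⟩ := ht
    rw [setIntegral_inter_of_indep h1 h2 h (stronglyMeasurable_condExp.mono h01)
        integrable_condExp (h01 _ hA) hC,
      setIntegral_inter_of_indep h1 h2 h hf hfi (h01 _ hA) hC, setIntegral_condExp h0 hfi hA]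
  | compl t ht ih =>
    rw [setIntegral_compl (hle _ ht) integrable_condExp, setIntegral_compl (hle _ ht) hfi,
      ih (measure_lt_top _ _), integral_condExp h0]
  | iUnion t hdisj ht ih =>
    rw [integral_iUnion (fun i => hle _ (ht i)) hdisj integrable_condExp.integrableOn,
      integral_iUnion (fun i => hle _ (ht i)) hdisj hfi.integrableOn]
    exact tsum_congr fun i => ih i (measure_lt_top _ _)

end ConditionalIndependence

section Pullback

variable {Ω Ω' : Type*} {m : MeasurableSpace Ω} [mΩ : MeasurableSpace Ω]
  [mΩ' : MeasurableSpace Ω'] {P : Measure Ω} {P' : Measure Ω'} {π : Ω' → Ω}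

theorem condExp_comap [IsFiniteMeasure P] [IsFiniteMeasure P'] (hπ : MeasurePreserving π P' P)
    (hm : m ≤ mΩ) {f : Ω → ℝ} (hf : Integrable f P) :
    P'[f ∘ π | m.comap π] =ᵐ[P'] P[f | m] ∘ π := by
  have hle : m.comap π ≤ mΩ' := (MeasurableSpace.comap_mono hm).trans hπ.measurable.comap_le
  refine (ae_eq_condExp_of_forall_setIntegral_eq hle (hπ.integrable_comp_of_integrable hf)
    (fun _ _ _ => (hπ.integrable_comp_of_integrable integrable_condExp).integrableOn) ?_
    (stronglyMeasurable_condExp.comp_measurable (comap_measurable π)).aestronglyMeasurable).symm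
  rintro _ ⟨s, hs, rfl⟩ -
  have hchange : ∀ {g : Ω → ℝ}, Integrable g P →
      ∫ ω in π ⁻¹' s, (g ∘ π) ω ∂P' = ∫ ω in s, g ω ∂P := fun {g} hg => by
    have hg' : AEStronglyMeasurable g (P'.map π) := hπ.map_eq.symm ▸ hg.aestronglyMeasurable
    rw [← hπ.map_eq, setIntegral_map (hm _ hs) hg' hπ.aemeasurable]
    rfl
  rw [hchange integrable_condExp, hchange hf, setIntegral_condExp hm hf hs]

theorem completion_comap_completion (hπ : MeasurePreserving π P' P) :
    completion P' ((completion P m).comap π) = completion P' (m.comap π) := by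
  refine le_antisymm (completion_le_completion ?_)
    (completion_mono (MeasurableSpace.comap_mono le_eventuallyMeasurableSpace))
  rintro _ ⟨s, ⟨t, ht, hst⟩, rfl⟩
  exact ⟨π ⁻¹' t, ⟨t, ht, rfl⟩, hπ.quasiMeasurePreserving.preimage_ae_eq hst⟩

end Pullback

section Immersion

variable {Ω : Type*} [mΩ : MeasurableSpace Ω] {P : Measure Ω}

theorem isImmersed_iff_forall_condExp_eq [IsFiniteMeasure P] {F H : NegFiltration P} :
    IsImmersed F H ↔
      ∀ n, F n ≤ H n ∧ ∀ B, MeasurableSet[H n] B → P⟦B | F 0⟧ =ᵐ[P] P⟦B | F n⟧ := by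
  have hpred : ∀ n, pred n ≤ n := fun n => (NonposInt.pred_lt n).le
  have hstep : IsImmersed F H ↔ ∀ n, F n ≤ H n ∧
      ∀ B, MeasurableSet[H (pred n)] B → P⟦B | F n⟧ =ᵐ[P] P⟦B | F (pred n)⟧ :=
    forall_congr' fun n => and_congr_right fun _ =>
      condIndepFields_iff_condExp_eq (F.mono' (hpred n)) (F.le' n) (H.le' _)
  rw [hstep]
  refine ⟨fun h n => ⟨(h n).1, ?_⟩, fun h n => ⟨(h n).1, fun B hB => ?_⟩⟩
  · induction n using NonposInt.induction_pred with
    | zero => exact fun _ _ => ae_eq_refl _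
    | pred n ih => exact fun B hB => (ih B (H.mono' (hpred n) B hB)).trans ((h n).2 B hB)
  · exact condExp_eq_of_le_of_le (F.mono' (hpred n)) (F.mono' n.le_zero) (F.le' 0)
      ((h (pred n)).2 B hB)

end Immersion

section ProductType

variable {Ω : Type*} [mΩ : MeasurableSpace Ω] {P : Measure Ω}

theorem iIndep_iff_forall_indep_iSup_Iio {ι : Type*} [LinearOrder ι] [IsProbabilityMeasure P]
    {m : ι → MeasurableSpace Ω} (hm : ∀ i, m i ≤ mΩ) :
    iIndep m P ↔ ∀ i, Indep (⨆ j ∈ Set.Iio i, m j) (m i) P := by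
  refine ⟨fun h i => ?_, fun h => (iIndep_iff m P).2 fun s => ?_⟩
  · simpa only [iSup_singleton] using indep_iSup_of_disjoint hm h (S := Set.Iio i) (T := {i})
      (Set.disjoint_singleton_right.2 (lt_irrefl i))
  · induction s using Finset.induction_on_max with
    | empty => simp
    | insert a s hs ih =>
      intro f hf
      rw [Finset.set_biInter_insert, Finset.prod_insert fun ha => lt_irrefl a (hs a ha),
        ← ih fun i hi => hf i (Finset.mem_insert_of_mem hi), Set.inter_comm, mul_comm]
      refine (Indep_iff _ _ _).1 (h a) _ _ (Finset.measurableSet_biInter s fun i hi => ?_)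
        (hf a (Finset.mem_insert_self a s))
      exact le_iSup₂ (f := fun j (_ : j ∈ Set.Iio a) => m j) i (hs i hi) _
        (hf i (Finset.mem_insert_of_mem hi))

theorem isProductType_iff_exists_iIndep {F : NegFiltration P} :
    IsProductType F ↔ ∃ m : NonposInt → MeasurableSpace Ω,
      (∀ n, @CountablyGenerated Ω (m n)) ∧ iIndep m P ∧ F.IsGeneratedBy m := by
  refine ⟨fun ⟨V, _, hV, hF⟩ => ⟨fun n => comap (V n) Real.measurableSpace,
    fun n => CountablyGenerated.comap (V n), (iIndepFun_iff_iIndep _ _ _).1 hV, hF⟩,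
    fun ⟨m, hm, hind, hF⟩ => ?_⟩
  choose V hV using fun n => exists_real_comap_eq (hm n)
  obtain rfl : (fun n => comap (V n) Real.measurableSpace) = m := funext hV
  exact ⟨V, fun n => measurable_iff_comap_le.2 ((hF.le le_rfl).trans (F.le' n)),
    (iIndepFun_iff_iIndep _ _ _).2 hind, hF⟩

end ProductType

section Reindex

variable {Ω : Type*} [mΩ : MeasurableSpace Ω] {P : Measure Ω} {s : NonposInt → NonposInt}

/-- The filtration `(F_{s(n)})_{n ≤ 0}`, for a time change `s` that may be constant on intervals:
this covers both the extraction and the slowing down of `F`. -/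
def NegFiltration.reindex (F : NegFiltration P) (s : NonposInt → NonposInt) (hs : Monotone s) :
    NegFiltration P where
  seq n := F (s n)
  mono' _ _ hmn := F.mono' (hs hmn)
  le' n := F.le' (s n)
  complete n := F.complete (s n)
  separable n := F.separable (s n)

theorem exists_mem_Ioc_apply_pred (hs : Monotone s) (hbot : ∀ m, ∃ n, s n ≤ m) {k n : NonposInt}
    (hk : k ≤ s n) : ∃ j ≤ n, k ∈ Set.Ioc (s (pred j)) (s j) := by
  obtain ⟨i, hi⟩ := hbot (pred k)
  have hbdd : BddBelow {j | k ≤ s j} := ⟨i, fun j hj => not_lt.1 fun hji =>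
    (hj.trans (hs hji.le)).not_gt (hi.trans_lt (NonposInt.pred_lt k))⟩
  have hne : {j | k ≤ s j}.Nonempty := ⟨n, hk⟩
  let j := hbdd.isWF.min hne
  exact ⟨j, hbdd.isWF.min_le hne hk, not_le.1 fun hj =>
    (NonposInt.pred_lt j).not_ge (hbdd.isWF.min_le hne hj), hbdd.isWF.min_mem hne⟩

theorem indep_iSup_Iio_iSup_Ioc [IsProbabilityMeasure P] {m : NonposInt → MeasurableSpace Ω}
    (hm : ∀ n, m n ≤ mΩ) (h : iIndep m P) (hs : Monotone s) (n : NonposInt) :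
    Indep (⨆ i ∈ Set.Iio n, ⨆ k ∈ Set.Ioc (s (pred i)) (s i), m k)
      (⨆ k ∈ Set.Ioc (s (pred n)) (s n), m k) P := by
  refine indep_of_indep_of_le_left (indep_iSup_of_disjoint hm h (S := Set.Iic (s (pred n)))
    (T := Set.Ioc (s (pred n)) (s n)) (Set.Iic_disjoint_Ioc le_rfl)) ?_
  exact iSup₂_le fun i hi => biSup_mono fun k hk =>
    hk.2.trans (hs (NonposInt.le_pred_of_lt hi))

theorem iSup_Iic_iSup_Ioc {α : Type*} [CompleteLattice α] (f : NonposInt → α) (hs : Monotone s)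
    (hbot : ∀ m, ∃ n, s n ≤ m) (n : NonposInt) :
    ⨆ j : Set.Iic n, ⨆ k ∈ Set.Ioc (s (pred j)) (s j), f k = ⨆ k : Set.Iic (s n), f k := by
  refine le_antisymm (iSup_le fun j => iSup₂_le fun k hk => ?_) (iSup_le fun k => ?_)
  · exact le_iSup (fun k : Set.Iic (s n) => f k) ⟨k, hk.2.trans (hs j.2)⟩
  · obtain ⟨j, hjn, hkj⟩ := exists_mem_Ioc_apply_pred hs hbot k.2
    exact le_iSup_of_le ⟨j, hjn⟩ (le_iSup₂_of_le k.1 hkj le_rfl)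

theorem IsProductType.reindex [IsProbabilityMeasure P] {H : NegFiltration P}
    (hH : IsProductType H) (hs : Monotone s) (hbot : ∀ m, ∃ n, s n ≤ m) :
    IsProductType (H.reindex s hs) := by
  obtain ⟨m, hm, hind, hgen⟩ := isProductType_iff_exists_iIndep.1 hH
  have hle : ∀ n, m n ≤ mΩ := fun n => (hgen.le le_rfl).trans (H.le' n)
  refine isProductType_iff_exists_iIndep.2 ⟨fun n => ⨆ k ∈ Set.Ioc (s (pred n)) (s n), m k,
    fun n => ?_, ?_, fun n => ?_⟩
  · exact countablyGenerated_iSup fun k => countablyGenerated_iSup fun _ => hm k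
  · exact (iIndep_iff_forall_indep_iSup_Iio fun n => iSup₂_le fun k _ => hle k).2
      (indep_iSup_Iio_iSup_Ioc hle hind hs)
  · rw [iSup_Iic_iSup_Ioc m hs hbot n]
    exact hgen (s n)

theorem IsImmersed.reindex [IsFiniteMeasure P] {F H : NegFiltration P} (h : IsImmersed F H)
    (hs : Monotone s) : IsImmersed (F.reindex s hs) (H.reindex s hs) := by
  rw [isImmersed_iff_forall_condExp_eq] at h ⊢
  exact fun n => ⟨(h (s n)).1, fun B hB => condExp_eq_of_le_of_le (F.mono' (hs n.le_zero))
    (F.mono' (NonposInt.le_zero _)) (F.le' 0) ((h (s n)).2 B hB)⟩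

theorem IsIsomorphic.reindex {Ω' : Type*} [MeasurableSpace Ω'] {P' : Measure Ω'}
    [IsFiniteMeasure P] [IsFiniteMeasure P'] {F : NegFiltration P} {F' : NegFiltration P'}
    (h : IsIsomorphic F F') (hs : Monotone s) :
    IsIsomorphic (F.reindex s hs) (F'.reindex s hs) := by
  obtain ⟨Z, Z', hZ, hZ', hlaw⟩ := h.exists_generators
  have hr : Measurable fun (z : NonposInt → ℝ) n => z (s n) :=
    measurable_pi_lambda _ fun n => measurable_pi_apply _
  have hZm : ∀ n, Measurable (Z n) := fun n => measurable_iff_comap_le.2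
    ((hZ n).comap_le.trans (F.le' n))
  have hZm' : ∀ n, Measurable (Z' n) := fun n => measurable_iff_comap_le.2
    ((hZ' n).comap_le.trans (F'.le' n))
  have hmap := congrArg (Measure.map fun z n => z (s n)) hlaw
  rw [Measure.map_map hr (measurable_pi_lambda _ hZm),
    Measure.map_map hr (measurable_pi_lambda _ hZm')] at hmap
  exact isIsomorphic_of_map_eq_map
    (NegFiltration.IsGeneratedBy.of_generates (F := F.reindex s hs) fun n => hZ (s n))
    (NegFiltration.IsGeneratedBy.of_generates (F := F'.reindex s hs) fun n => hZ' (s n)) hmap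

theorem IsStandard.reindex {Ω : Type u} [MeasurableSpace Ω] {P : Measure Ω} [IsFiniteMeasure P]
    {F : NegFiltration P} (h : IsStandard F) (hs : Monotone s) (hbot : ∀ m, ∃ n, s n ≤ m) :
    IsStandard (F.reindex s hs) := by
  obtain ⟨Ω', _, P', hP', H, hH, F', hiso, himm⟩ := h
  exact ⟨Ω', _, P', hP', H.reindex s hs, hH.reindex hs hbot, F'.reindex s hs, hiso.reindex hs,
    himm.reindex hs⟩

end Reindex

section Randomization

theorem measurePreserving_id_completion {Ω : Type*} [MeasurableSpace Ω] (P : Measure Ω) :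
    @MeasurePreserving (NullMeasurableSpace Ω P) Ω _ _ id P.completion P := by
  have hid : @Measurable (NullMeasurableSpace Ω P) Ω _ _ id :=
    fun _ hs => MeasurableSet.nullMeasurableSet hs
  exact ⟨hid, Measure.ext fun s hs =>
    (Measure.map_apply hid hs).trans (Measure.completion_apply P s)⟩

theorem exists_complete_uniform_extension {Ω : Type u} [MeasurableSpace Ω] (P : Measure Ω)
    [IsProbabilityMeasure P] :
    ∃ (Ω₁ : Type u) (_ : MeasurableSpace Ω₁) (P₁ : Measure Ω₁) (π : Ω₁ → Ω)
      (U : Ω₁ → unitInterval), P₁.IsComplete ∧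
      MeasurePreserving (fun ω => (π ω, U ω)) P₁ (P.prod volume) :=
  ⟨NullMeasurableSpace (Ω × unitInterval) (P.prod volume), inferInstance,
    (P.prod volume).completion, fun ω => Prod.fst ω, fun ω => Prod.snd ω,
    Measure.completion.isComplete _, measurePreserving_id_completion _⟩

theorem map_prodMk_eq_compProd {Ω E β I : Type*} [MeasurableSpace Ω] [MeasurableSpace E]
    [MeasurableSpace β] [MeasurableSpace I] {P : Measure Ω} {μ : Measure E} [SFinite μ]
    {ν : Measure I} [SFinite ν] {X : Ω → E} {U : Ω → I} {κ : Kernel E β} [IsSFiniteKernel κ]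
    {g : E → I → β} (h : MeasurePreserving (fun ω => (X ω, U ω)) P (μ.prod ν))
    (hg : Measurable (Function.uncurry g)) (hgκ : ∀ x, ν.map (g x) = κ x) :
    P.map (fun ω => (X ω, g (X ω) (U ω))) = μ ⊗ₘ κ := by
  have hm : Measurable fun p : E × I => (p.1, g p.1 p.2) := measurable_fst.prodMk hg
  have hmap := Measure.map_map (μ := P) hm h.measurable
  rw [h.map_eq] at hmap
  refine hmap.symm.trans (Measure.ext fun s hs => ?_)
  rw [Measure.map_apply hm hs, Measure.prod_apply (hm hs), Measure.compProd_apply hs]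
  refine lintegral_congr fun x => ?_
  rw [← hgκ, Measure.map_apply hg.of_uncurry_left (measurable_prodMk_left hs)]
  rfl

theorem exists_map_prodMk_eq {Ω Ω' E β : Type*} [MeasurableSpace Ω] [MeasurableSpace Ω']
    [MeasurableSpace E] [MeasurableSpace β] [StandardBorelSpace β] [Nonempty β] {P : Measure Ω}
    [IsFiniteMeasure P] {P' : Measure Ω'} {X : Ω → E} {Z : Ω → β} {X' : Ω' → E}
    {U : Ω' → unitInterval} (hZ : Measurable Z)
    (h : MeasurePreserving (fun ω => (X' ω, U ω)) P' ((P.map X).prod volume)) :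
    ∃ g : E → unitInterval → β, Measurable (Function.uncurry g) ∧
      P.map (fun ω => (X ω, Z ω)) = P'.map (fun ω => (X' ω, g (X' ω) (U ω))) := by
  obtain ⟨g, hg, hgκ⟩ := (condDistrib Z X P).exists_measurable_map_eq_unitInterval
  exact ⟨g, hg, by rw [map_prodMk_eq_compProd h hg hgκ, compProd_map_condDistrib hZ.aemeasurable]⟩

end Randomization

section Prolongation

/-- The completed natural filtration of a sequence of countably generated σ-fields. -/
def NegFiltration.natural {Ω : Type*} [mΩ : MeasurableSpace Ω] (P : Measure Ω) [P.IsComplete]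
    (m : NonposInt → MeasurableSpace Ω) (hm : ∀ n, @CountablyGenerated Ω (m n))
    (hle : ∀ n, m n ≤ mΩ) : NegFiltration P where
  seq n := completion P (⨆ k : Set.Iic n, m k)
  mono' _ _ hjn := completion_mono (iSup_le fun k =>
    le_iSup_of_le ⟨k, k.2.trans hjn⟩ le_rfl)
  le' n := completion_le (iSup_le fun k => hle k)
  complete n _ hs :=
    ⟨∅, @MeasurableSet.empty _ (⨆ k : Set.Iic n, m k), ae_eq_empty.2 hs⟩
  separable n := by
    have hsup := countablyGenerated_iSup (m := fun k : Set.Iic n => m k) fun k => hm k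
    exact ⟨@MeasurableSpace.natGeneratingSequence Ω (⨆ k : Set.Iic n, m k) hsup, by
      rw [@MeasurableSpace.generateFrom_natGeneratingSequence Ω (⨆ k : Set.Iic n, m k) hsup]⟩

/-- `F₁` is the lift by `π` of the filtration `F`, moved one step to the past and followed at
time `0` by the innovation `𝒲`. -/
structure IsProlongation {Ω Ω₁ : Type*} (𝒲 : MeasurableSpace Ω₁) [MeasurableSpace Ω]
    [MeasurableSpace Ω₁] {P : Measure Ω} {P₁ : Measure Ω₁} (π : Ω₁ → Ω) (F : NegFiltration P)
    (F₁ : NegFiltration P₁) : Prop where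
  apply_pred : ∀ n, F₁ (pred n) = completion P₁ ((F n).comap π)
  apply_zero : F₁ 0 = completion P₁ ((F 0).comap π ⊔ 𝒲)

variable {Ω Ω₁ : Type*} {m₁ m₂ : MeasurableSpace Ω} {m : NonposInt → MeasurableSpace Ω}
  {𝒰 𝒲 : MeasurableSpace Ω₁} [mΩ : MeasurableSpace Ω] [mΩ₁ : MeasurableSpace Ω₁] {P : Measure Ω}
  {P₁ : Measure Ω₁} {π : Ω₁ → Ω}

theorem countablyGenerated_snoc_comap {Ω Ω₁ : Type*} {m : NonposInt → MeasurableSpace Ω}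
    {𝒲 : MeasurableSpace Ω₁} (π : Ω₁ → Ω) (hm : ∀ n, @CountablyGenerated Ω (m n))
    (h𝒲 : @CountablyGenerated Ω₁ 𝒲) (n : NonposInt) :
    @CountablyGenerated Ω₁ (snoc (fun n => (m n).comap π) 𝒲 n) :=
  (forall_snoc (p := fun a => @CountablyGenerated Ω₁ a) (fun n => (m n).comap π) 𝒲).2
    ⟨h𝒲, fun n => @CountablyGenerated.comap _ _ (m n) (hm n) π⟩ n

theorem NegFiltration.IsGeneratedBy.isProlongation {F : NegFiltration P} {F₁ : NegFiltration P₁}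
    (hπ : MeasurePreserving π P₁ P) (hF : F.IsGeneratedBy m)
    (hF₁ : F₁.IsGeneratedBy (snoc (fun n => (m n).comap π) 𝒲)) : IsProlongation 𝒲 π F F₁ where
  apply_pred n := by
    rw [hF₁, hF n, iSup_Iic_pred_snoc, completion_comap_completion hπ, MeasurableSpace.comap_iSup]
  apply_zero := by
    rw [hF₁, hF 0, iSup_Iic_zero_snoc, ← MeasurableSpace.comap_iSup]
    exact completion_sup_congr (completion_comap_completion hπ).symm

theorem NegFiltration.IsGeneratedBy.exists_isProlongation [P₁.IsComplete] {F : NegFiltration P}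
    (hF : F.IsGeneratedBy m) (hm : ∀ n, @CountablyGenerated Ω (m n))
    (hπ : MeasurePreserving π P₁ P) (h𝒲 : 𝒲 ≤ mΩ₁) (h𝒲c : @CountablyGenerated Ω₁ 𝒲) :
    ∃ F₁ : NegFiltration P₁, F₁.IsGeneratedBy (snoc (fun n => (m n).comap π) 𝒲) ∧
      IsProlongation 𝒲 π F F₁ := by
  let m' := snoc (fun n => (m n).comap π) 𝒲
  have hmπ : ∀ n, @CountablyGenerated Ω₁ (m' n) := countablyGenerated_snoc_comap π hm h𝒲c
  have hle : ∀ n, m' n ≤ mΩ₁ := (forall_snoc (p := (· ≤ mΩ₁)) _ _).2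
    ⟨h𝒲, fun n => (MeasurableSpace.comap_mono ((hF.le le_rfl).trans (F.le' n))).trans
      hπ.measurable.comap_le⟩
  have hF₁ : (NegFiltration.natural P₁ m' hmπ hle).IsGeneratedBy m' := fun _ => rfl
  exact ⟨_, hF₁, hF.isProlongation hπ hF₁⟩

theorem IsProlongation.condExp_apply_pred [IsFiniteMeasure P] [IsFiniteMeasure P₁]
    {F : NegFiltration P} {F₁ : NegFiltration P₁} (hF : IsProlongation 𝒲 π F F₁)
    (hπ : MeasurePreserving π P₁ P) {B : Set Ω} (hB : MeasurableSet B) (n : NonposInt) :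
    P₁⟦π ⁻¹' B | F₁ (pred n)⟧ =ᵐ[P₁] P⟦B | F n⟧ ∘ π := by
  have := F₁.isComplete
  rw [hF.apply_pred n]
  exact (condExp_completion ((MeasurableSpace.comap_mono (F.le' n)).trans hπ.measurable.comap_le)
    (integrable_indicator_one (hπ.measurable hB))).trans
      (condExp_comap hπ (F.le' n) (integrable_indicator_one hB))

theorem IsProlongation.condExp_apply_zero [IsFiniteMeasure P] [IsFiniteMeasure P₁]
    {F : NegFiltration P} {F₁ : NegFiltration P₁} (hF : IsProlongation 𝒲 π F F₁)
    (hπ : MeasurePreserving π P₁ P) (h𝒰 : 𝒰 ≤ mΩ₁) (hind : Indep (mΩ.comap π) 𝒰 P₁)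
    (h𝒲 : 𝒲 ≤ (F 0).comap π ⊔ 𝒰) {B : Set Ω} (hB : MeasurableSet B) :
    P₁⟦π ⁻¹' B | F₁ 0⟧ =ᵐ[P₁] P₁⟦π ⁻¹' B | F₁ (pred 0)⟧ := by
  have := F₁.isComplete
  have hπle : mΩ.comap π ≤ mΩ₁ := hπ.measurable.comap_le
  have hFle : (F 0).comap π ≤ mΩ.comap π := MeasurableSpace.comap_mono (F.le' 0)
  have hint : Integrable ((π ⁻¹' B).indicator fun _ => (1 : ℝ)) P₁ :=
    integrable_indicator_one (hπ.measurable hB)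
  have hsm : StronglyMeasurable[mΩ.comap π] ((π ⁻¹' B).indicator fun _ => (1 : ℝ)) :=
    stronglyMeasurable_one.indicator ⟨B, hB, rfl⟩
  have hsup : (F 0).comap π ⊔ 𝒰 ≤ mΩ₁ := sup_le (hFle.trans hπle) h𝒰
  refine condExp_eq_of_le_of_le (F₁.mono' (NonposInt.le_zero _))
    (hF.apply_zero.le.trans (completion_mono (sup_le le_sup_left h𝒲))) (completion_le hsup) ?_
  rw [hF.apply_pred]
  calc P₁⟦π ⁻¹' B | completion P₁ ((F 0).comap π ⊔ 𝒰)⟧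
      =ᵐ[P₁] P₁⟦π ⁻¹' B | (F 0).comap π ⊔ 𝒰⟧ := condExp_completion hsup hint
    _ =ᵐ[P₁] P₁⟦π ⁻¹' B | (F 0).comap π⟧ := condExp_sup_of_indep hFle hπle h𝒰 hind hsm hint
    _ =ᵐ[P₁] P₁⟦π ⁻¹' B | completion P₁ ((F 0).comap π)⟧ :=
        (condExp_completion (hFle.trans hπle) hint).symm

theorem IsImmersed.of_isProlongation [IsFiniteMeasure P] [IsFiniteMeasure P₁]
    {F H : NegFiltration P} {F₁ H₁ : NegFiltration P₁} (h : IsImmersed F H)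
    (hF : IsProlongation 𝒲 π F F₁) (hH : IsProlongation 𝒰 π H H₁)
    (hπ : MeasurePreserving π P₁ P) (h𝒰 : 𝒰 ≤ mΩ₁) (hind : Indep (mΩ.comap π) 𝒰 P₁)
    (h𝒲 : 𝒲 ≤ (F 0).comap π ⊔ 𝒰) : IsImmersed F₁ H₁ := by
  rw [isImmersed_iff_forall_condExp_eq] at h ⊢
  intro n
  induction n using NonposInt.cases_pred with
  | zero =>
    refine ⟨?_, fun _ _ => ae_eq_refl _⟩
    rw [hF.apply_zero, hH.apply_zero]
    exact completion_mono (sup_le (le_sup_of_le_left (MeasurableSpace.comap_mono (h 0).1))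
      (h𝒲.trans (sup_le_sup_right (MeasurableSpace.comap_mono (h 0).1) _)))
  | pred n =>
    refine ⟨?_, fun B hB => ?_⟩
    · rw [hF.apply_pred, hH.apply_pred]
      exact completion_mono (MeasurableSpace.comap_mono (h n).1)
    rw [hH.apply_pred] at hB
    obtain ⟨_, ⟨B₀, hB₀, rfl⟩, hBB₀⟩ := hB
    have hB₀m : MeasurableSet B₀ := H.le' n _ hB₀
    calc P₁⟦B | F₁ 0⟧ =ᵐ[P₁] P₁⟦π ⁻¹' B₀ | F₁ 0⟧ := condExp_congr_set hBB₀
      _ =ᵐ[P₁] P₁⟦π ⁻¹' B₀ | F₁ (pred 0)⟧ := hF.condExp_apply_zero hπ h𝒰 hind h𝒲 hB₀m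
      _ =ᵐ[P₁] P⟦B₀ | F 0⟧ ∘ π := hF.condExp_apply_pred hπ hB₀m 0
      _ =ᵐ[P₁] P⟦B₀ | F n⟧ ∘ π := hπ.quasiMeasurePreserving.ae_eq_comp ((h n).2 B₀ hB₀)
      _ =ᵐ[P₁] P₁⟦π ⁻¹' B₀ | F₁ (pred n)⟧ := (hF.condExp_apply_pred hπ hB₀m n).symm
      _ =ᵐ[P₁] P₁⟦B | F₁ (pred n)⟧ := (condExp_congr_set hBB₀).symm

theorem indep_comap (hπ : MeasurePreserving π P₁ P) (h1 : m₁ ≤ mΩ)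
    (h2 : m₂ ≤ mΩ) (h : Indep m₁ m₂ P) : Indep (m₁.comap π) (m₂.comap π) P₁ := by
  rw [Indep_iff] at h ⊢
  rintro _ _ ⟨s, hs, rfl⟩ ⟨t, ht, rfl⟩
  rw [← Set.preimage_inter,
    hπ.measure_preimage ((h1 s hs).inter (h2 t ht)).nullMeasurableSet,
    hπ.measure_preimage (h1 s hs).nullMeasurableSet,
    hπ.measure_preimage (h2 t ht).nullMeasurableSet, h s t hs ht]

theorem iIndep_snoc [IsProbabilityMeasure P] [IsProbabilityMeasure P₁]
    (hπ : MeasurePreserving π P₁ P) (hm : ∀ n, m n ≤ mΩ) (h : iIndep m P) (h𝒰 : 𝒰 ≤ mΩ₁)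
    (hind : Indep (mΩ.comap π) 𝒰 P₁) : iIndep (snoc (fun n => (m n).comap π) 𝒰) P₁ := by
  have hcomap : ∀ n, (m n).comap π ≤ mΩ.comap π := fun n => MeasurableSpace.comap_mono (hm n)
  have hle : ∀ n, snoc (fun n => (m n).comap π) 𝒰 n ≤ mΩ₁ :=
    (forall_snoc (p := (· ≤ mΩ₁)) _ _).2 ⟨h𝒰, fun n => (hcomap n).trans hπ.measurable.comap_le⟩
  rw [iIndep_iff_forall_indep_iSup_Iio hm] at h
  refine (iIndep_iff_forall_indep_iSup_Iio hle).2 (NonposInt.cases_pred ?_ fun n => ?_)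
  · rw [snoc_zero]
    refine indep_of_indep_of_le_left hind (iSup₂_le fun j hj => ?_)
    induction j using NonposInt.cases_pred with
    | zero => exact absurd hj (lt_irrefl (0 : NonposInt))
    | pred j => exact (snoc_pred _ _ j).le.trans (hcomap j)
  · rw [snoc_pred]
    refine indep_of_indep_of_le_left (indep_comap hπ (iSup₂_le fun j _ => hm j) (hm n) (h n))
      (iSup₂_le fun j hj => ?_)
    induction j using NonposInt.cases_pred with
    | zero => exact absurd hj (NonposInt.le_zero _).not_gt
    | pred j =>
      rw [snoc_pred]
      exact MeasurableSpace.comap_mono (le_iSup₂ (f := fun j (_ : j ∈ Set.Iio n) => m j) j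
        (NonposInt.pred_strictMono.lt_iff_lt.1 hj))

theorem IsProductType.exists_isProlongation [IsProbabilityMeasure P] [IsProbabilityMeasure P₁]
    [P₁.IsComplete] {H : NegFiltration P} (hH : IsProductType H) (hπ : MeasurePreserving π P₁ P)
    (h𝒰 : 𝒰 ≤ mΩ₁) (h𝒰c : @CountablyGenerated Ω₁ 𝒰) (hind : Indep (mΩ.comap π) 𝒰 P₁) :
    ∃ H₁ : NegFiltration P₁, IsProductType H₁ ∧ IsProlongation 𝒰 π H H₁ := by
  obtain ⟨m, hm, hmind, hgen⟩ := isProductType_iff_exists_iIndep.1 hH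
  have hmle : ∀ n, m n ≤ mΩ := fun n => (hgen.le le_rfl).trans (H.le' n)
  obtain ⟨H₁, hgen₁, hH₁⟩ := hgen.exists_isProlongation hm hπ h𝒰 h𝒰c
  exact ⟨H₁, isProductType_iff_exists_iIndep.2 ⟨snoc (fun n => (m n).comap π) 𝒰,
    countablyGenerated_snoc_comap π hm h𝒰c, iIndep_snoc hπ hmle hmind h𝒰 hind, hgen₁⟩, hH₁⟩

end Prolongation

section ReindexPred

variable {Ω : Type*} {Ω' : Type u} [mΩ : MeasurableSpace Ω] [mΩ' : MeasurableSpace Ω']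
  {P : Measure Ω} {P' : Measure Ω'}

theorem isProbabilityMeasure_of_measurePreserving {β : Type*} [MeasurableSpace β] {μ : Measure β}
    [hμ : IsProbabilityMeasure μ] {X : Ω → β} (h : MeasurePreserving X P μ) :
    IsProbabilityMeasure P := by
  rw [← h.map_eq] at hμ
  exact Measure.isProbabilityMeasure_of_map X

theorem measurePreserving_and_indepFun_of_prod {Ω₁ β γ : Type*} [MeasurableSpace Ω₁]
    [MeasurableSpace β] [MeasurableSpace γ] {P₁ : Measure Ω₁} {μ : Measure β} {ν : Measure γ}
    [IsProbabilityMeasure μ] [IsProbabilityMeasure ν] {X : Ω₁ → β} {Y : Ω₁ → γ}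
    (h : MeasurePreserving (fun ω => (X ω, Y ω)) P₁ (μ.prod ν)) :
    MeasurePreserving X P₁ μ ∧ MeasurePreserving Y P₁ ν ∧ IndepFun X Y P₁ := by
  have hX : MeasurePreserving X P₁ μ := measurePreserving_fst.comp h
  have hY : MeasurePreserving Y P₁ ν := measurePreserving_snd.comp h
  have := isProbabilityMeasure_of_measurePreserving hX
  refine ⟨hX, hY, (indepFun_iff_map_prod_eq_prod_map_map hX.aemeasurable hY.aemeasurable).2 ?_⟩
  rw [h.map_eq, hX.map_eq, hY.map_eq]

theorem exists_extension_map_prodMk_eq {E β : Type*} [MeasurableSpace E] [mβ : MeasurableSpace β]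
    [StandardBorelSpace β] [Nonempty β] [IsProbabilityMeasure P] [IsProbabilityMeasure P']
    {X : Ω → E} {X' : Ω' → E} (hX' : Measurable X') (hXX' : P.map X = P'.map X')
    {Z : Ω → β} (hZ : Measurable Z) :
    ∃ (Ω₁ : Type u) (_ : MeasurableSpace Ω₁) (P₁ : Measure Ω₁) (π : Ω₁ → Ω')
      (U : Ω₁ → unitInterval) (W : Ω₁ → β), P₁.IsComplete ∧ MeasurePreserving π P₁ P' ∧
      Measurable U ∧ IndepFun π U P₁ ∧
      mβ.comap W ≤ (comap X' inferInstance).comap π ⊔ comap U inferInstance ∧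
      P.map (fun ω => (X ω, Z ω)) = P₁.map (fun ω => (X' (π ω), W ω)) := by
  obtain ⟨Ω₁, _, P₁, π, U, hc, hπU⟩ := exists_complete_uniform_extension P'
  obtain ⟨hπ, hU, hind⟩ := measurePreserving_and_indepFun_of_prod hπU
  have hX'U : MeasurePreserving (fun ω => (X' (π ω), U ω)) P₁ ((P.map X).prod volume) := by
    rw [hXX']
    have := P'.isProbabilityMeasure_map hX'.aemeasurable
    exact ((hX'.measurePreserving P').prod (MeasurePreserving.id volume)).comp hπU
  obtain ⟨g, hg, hlaw⟩ := exists_map_prodMk_eq hZ hX'U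
  refine ⟨Ω₁, _, P₁, π, U, fun ω => g (X' (π ω)) (U ω), hc, hπ, hU.measurable, hind, ?_, hlaw⟩
  rw [MeasurableSpace.comap_comp, ← MeasurableSpace.comap_prodMk]
  exact (hg.comp (comap_measurable fun ω => (X' (π ω), U ω))).comap_le

theorem map_snoc_eq_map_snoc {β : Type*} [MeasurableSpace β] {Y : NonposInt → Ω → β} {Z : Ω → β}
    {Y' : NonposInt → Ω' → β} {Z' : Ω' → β} (hY : ∀ n, Measurable (Y n)) (hZ : Measurable Z)
    (hY' : ∀ n, Measurable (Y' n)) (hZ' : Measurable Z')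
    (h : P.map (fun ω => (fun n => Y n ω, Z ω)) = P'.map (fun ω => (fun n => Y' n ω, Z' ω))) :
    P.map (fun ω n => snoc Y Z n ω) = P'.map (fun ω n => snoc Y' Z' n ω) := by
  have hsnoc : Measurable fun (p : (NonposInt → β) × β) n => snoc p.1 p.2 n := by
    refine measurable_pi_lambda _ fun n => ?_
    induction n using NonposInt.cases_pred with
    | zero => simpa only [snoc_zero] using measurable_snd
    | pred n =>
      simpa only [snoc_pred, Function.comp_def] using (measurable_pi_apply n).comp measurable_fst
  have hmap := congrArg (Measure.map fun (p : (NonposInt → β) × β) n => snoc p.1 p.2 n) h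
  rw [Measure.map_map hsnoc ((measurable_pi_lambda _ hY).prodMk hZ),
    Measure.map_map hsnoc ((measurable_pi_lambda _ hY').prodMk hZ')] at hmap
  have hYZ : ∀ ω n, snoc Y Z n ω = snoc (Y · ω) (Z ω) n := fun ω => apply_snoc Y Z (· ω)
  have hYZ' : ∀ ω n, snoc Y' Z' n ω = snoc (Y' · ω) (Z' ω) n := fun ω => apply_snoc Y' Z' (· ω)
  simp only [hYZ, hYZ']
  exact hmap

end ReindexPred

theorem IsStandard.of_reindex_pred {Ω : Type u} [MeasurableSpace Ω] {P : Measure Ω}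
    [IsProbabilityMeasure P] {F : NegFiltration P}
    (h : IsStandard (F.reindex pred NonposInt.pred_strictMono.monotone)) : IsStandard F := by
  obtain ⟨Ω', _, P', _, H, hH, F', hiso, himm⟩ := h
  obtain ⟨Y, Y', hY, hY', hlaw⟩ := hiso.exists_generators
  obtain ⟨Z, hZ⟩ := F.exists_generates 0
  have hYm : ∀ n, Measurable (Y n) := fun n => measurable_iff_comap_le.2
    ((hY n).comap_le.trans (F.le' (pred n)))
  have hYm' : ∀ n, Measurable (Y' n) := fun n => measurable_iff_comap_le.2
    ((hY' n).comap_le.trans (F'.le' n))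
  have hZm : Measurable Z := measurable_iff_comap_le.2 (hZ.comap_le.trans (F.le' 0))
  obtain ⟨Ω₁, _, P₁, π, U, W, _, hπ, hU, hind, hW, hjoint⟩ :=
    exists_extension_map_prodMk_eq (measurable_pi_lambda _ hYm') hlaw hZm
  have : IsProbabilityMeasure P₁ := isProbabilityMeasure_of_measurePreserving hπ
  have hY'0 : comap (fun ω n => Y' n ω) MeasurableSpace.pi ≤ F' 0 := by
    rw [comap_pi_eq_iSup]
    exact iSup_le fun n => (hY' n).comap_le.trans (F'.mono' n.le_zero)
  have hW' := hW.trans (sup_le_sup_right (MeasurableSpace.comap_mono hY'0) _)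
  have hWm : Measurable W := measurable_iff_comap_le.2 (hW'.trans (sup_le
    ((MeasurableSpace.comap_mono (F'.le' 0)).trans hπ.measurable.comap_le) hU.comap_le))
  obtain ⟨F₁, hgen₁, hF₁⟩ := (NegFiltration.IsGeneratedBy.of_generates hY').exists_isProlongation
    (fun n => CountablyGenerated.comap (Y' n)) hπ hWm.comap_le (CountablyGenerated.comap W)
  obtain ⟨H₁, hH₁, hHH₁⟩ := hH.exists_isProlongation hπ hU.comap_le
    (CountablyGenerated.comap U) hind
  refine ⟨Ω₁, _, P₁, this, H₁, hH₁, F₁, isIsomorphic_of_map_eq_map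
    (Z := snoc Y Z) (Z' := snoc (fun n ω => Y' n (π ω)) W) (.of_generates ?_) ?_
    (map_snoc_eq_map_snoc hYm hZm (fun n => (hYm' n).comp hπ.measurable) hWm hjoint),
    himm.of_isProlongation hF₁ hHH₁ hπ hU.comap_le hind hW'⟩
  · refine NonposInt.cases_pred ?_ fun n => ?_
    · simpa only [snoc_zero] using hZ
    · rw [snoc_pred]
      exact hY n
  · convert hgen₁ using 2 with n
    rw [apply_snoc _ _ (comap · Real.measurableSpace)]
    simp only [MeasurableSpace.comap_comp, Function.comp_def]

section Criteria

variable {Ω : Type u} [MeasurableSpace Ω] {P : Measure Ω} [IsProbabilityMeasure P]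
  {F : NegFiltration P} {s : NonposInt → NonposInt}

theorem IsStandard.of_reindex_iterate_pred (c : ℕ)
    (h : IsStandard (F.reindex pred^[c] (NonposInt.pred_strictMono.monotone.iterate c))) :
    IsStandard F := by
  induction c with
  | zero => exact h
  | succ c ih => exact ih (.of_reindex_pred h)

theorem IsStandard.of_reindex (hs : Monotone s) (c : ℕ) (hrange : ∀ n, pred^[c] n ∈ Set.range s)
    (h : IsStandard (F.reindex s hs)) : IsStandard F := by
  choose t ht using hrange
  have htmono : StrictMono t := fun m n hmn => hs.reflect_lt <| by
    rw [ht, ht]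
    exact NonposInt.pred_strictMono.iterate c hmn
  have hst := h.reindex htmono.monotone fun m => ⟨m, le_self_of_strictMono htmono m⟩
  refine .of_reindex_iterate_pred c ?_
  simp only [show pred^[c] = s ∘ t from (funext ht).symm]
  exact hst

theorem IsAtThreshold.isStandard_reindex (hF : IsAtThreshold F) (hs : Monotone s)
    (hbot : ∀ m, ∃ n, s n ≤ m) (hcompl : (Set.range s)ᶜ.Infinite) :
    IsStandard (F.reindex s hs) := by
  have hrange : (Set.range s).Infinite := NonposInt.infinite_of_forall_exists_le fun m =>
    let ⟨n, hn⟩ := hbot m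
    ⟨s n, ⟨n, rfl⟩, hn⟩
  obtain ⟨ψ, hψ, hψs⟩ := NonposInt.exists_strictMono_range_eq hrange
  have hmem : ∀ n, ∃ r, ψ r = s n := fun n => hψs.ge ⟨n, rfl⟩
  choose r hr using hmem
  have hrmono : Monotone r := fun m n hmn => hψ.le_iff_le.1 <| by
    rw [hr, hr]
    exact hs hmn
  have hrbot : ∀ m, ∃ n, r n ≤ m := fun m =>
    let ⟨n, hn⟩ := hbot (ψ m)
    ⟨n, hψ.le_iff_le.1 ((hr n).trans_le hn)⟩
  obtain rfl : ψ ∘ r = s := funext hr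
  exact (hF.2 ψ hψ (hψs ▸ hcompl)).reindex hrmono hrbot

end Criteria

section TimeChange

variable {φ : NonposInt → NonposInt} (hφ : StrictMono φ) (h0 : φ 0 = 0) {n k : NonposInt}

theorem slowIndex_le_iff : slowIndex φ hφ h0 n ≤ k ↔ n ≤ φ k := by
  refine ⟨fun h => ?_, fun h => csInf_le (slowSet_bddBelow hφ n) ⟨k.2, h⟩⟩
  obtain ⟨_, hn⟩ := Int.csInf_mem ⟨0, zero_mem_slowSet h0 n⟩ (slowSet_bddBelow hφ n)
  exact le_trans hn (hφ.monotone h)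

theorem slowIndex_eq_iff : slowIndex φ hφ h0 n = k ↔ φ (pred k) < n ∧ n ≤ φ k := by
  refine ⟨?_, fun ⟨h1, h2⟩ => slowIndex_eq hφ h0 n k (Int.add_one_le_of_lt h1) h2⟩
  rintro rfl
  exact ⟨not_le.1 fun h => (NonposInt.pred_lt _).not_ge ((slowIndex_le_iff hφ h0).2 h),
    (slowIndex_le_iff hφ h0).1 le_rfl⟩

/-- The index of the block of the time change `interlinkTime` containing `n`: the slowed filtration
is `n ↦ F (interlinkIndex n)`. -/
noncomputable def interlinkIndex : NonposInt → NonposInt :=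
  slowIndex interlinkTime interlinkTime_strictMono interlinkTime_zero

theorem interlinkIndex_mono : Monotone interlinkIndex :=
  slowIndex_mono interlinkTime_strictMono interlinkTime_zero

theorem exists_interlinkIndex_comp_le {ρ : NonposInt → NonposInt} (hρ : StrictMono ρ)
    (m : NonposInt) : ∃ n, (interlinkIndex ∘ ρ) n ≤ m :=
  ⟨interlinkTime m, (slowIndex_le_iff interlinkTime_strictMono interlinkTime_zero).2
    (le_self_of_strictMono hρ _)⟩

theorem interlinkIndex_eq_even_iff {N : ℕ} (hN : 1 ≤ N) (hk : (k : ℤ) = 2 * -(N : ℤ)) :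
    interlinkIndex n = k ↔ (n : ℤ) = -2 ^ N := by
  have hφk : ((interlinkTime k : NonposInt) : ℤ) = -2 ^ N := by
    change interlinkVal k = _
    rw [hk, interlinkVal_even _ (by omega), Int.natAbs_neg, Int.natAbs_natCast]
  have hφk' : ((interlinkTime (pred k) : NonposInt) : ℤ) = -2 ^ N - 1 := by
    change interlinkVal (k - 1) = _
    rw [hk, interlinkVal_odd _ (by omega), Int.natAbs_neg, Int.natAbs_natCast]
  rw [interlinkIndex, slowIndex_eq_iff, ← Subtype.coe_lt_coe, ← Subtype.coe_le_coe, hφk, hφk']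
  omega

theorem interlinkIndex_eq_odd_iff {N : ℕ} (hN : 1 ≤ N) (hk : (k : ℤ) = 2 * -(N : ℤ) - 1) :
    interlinkIndex n = k ↔ -2 ^ (N + 1) < (n : ℤ) ∧ (n : ℤ) < -2 ^ N := by
  have hφk : ((interlinkTime k : NonposInt) : ℤ) = -2 ^ N - 1 := by
    change interlinkVal k = _
    rw [hk, interlinkVal_odd _ (by omega), Int.natAbs_neg, Int.natAbs_natCast]
  have hφk' : ((interlinkTime (pred k) : NonposInt) : ℤ) = -2 ^ (N + 1) := by
    change interlinkVal (k - 1) = _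
    rw [hk, show 2 * -(N : ℤ) - 1 - 1 = 2 * -((N + 1 : ℕ) : ℤ) by omega,
      interlinkVal_even _ (by omega), Int.natAbs_neg, Int.natAbs_natCast]
  rw [interlinkIndex, slowIndex_eq_iff, ← Subtype.coe_lt_coe, ← Subtype.coe_le_coe, hφk, hφk']
  omega

theorem mem_range_interlinkIndex_comp_dyadicTime {d : ℕ} (hk : (k : ℤ) ≤ -(2 * d + 2)) :
    k ∈ Set.range (interlinkIndex ∘ dyadicTime d) := by
  obtain ⟨r, hr⟩ : ∃ r : ℕ, (k : ℤ) = 2 * -((d + 1 + r : ℕ) : ℤ) ∨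
      (k : ℤ) = 2 * -((d + 1 + r : ℕ) : ℤ) - 1 := ⟨((-k - 2 * d - 2 : ℤ) / 2).toNat, by omega⟩
  have hpow : (2 : ℤ) ^ (d + 1 + r) = 2 ^ d * 2 ^ (r + 1) := by ring
  rcases hr with hr | hr
  · refine ⟨⟨-2 ^ (r + 1), by simp⟩, (interlinkIndex_eq_even_iff (by omega) hr).2 ?_⟩
    simp only [dyadicTime, hpow, mul_neg]
  · have hd : (0 : ℤ) < 2 ^ d := by positivity
    have hr1 : (1 : ℤ) < 2 ^ (r + 1) := one_lt_pow₀ (by norm_num) (by omega)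
    refine ⟨⟨-(2 ^ (r + 1) + 1), by omega⟩, (interlinkIndex_eq_odd_iff (by omega) hr).2 ?_⟩
    rw [dyadicTime, pow_succ, hpow]
    constructor <;> nlinarith

theorem notMem_range_interlinkIndex_comp_shiftedDyadicTime {d N : ℕ} (hd : 1 ≤ d) (hN : d ≤ N)
    (hk : (k : ℤ) = 2 * -(N : ℤ)) : k ∉ Set.range (interlinkIndex ∘ shiftedDyadicTime d) := by
  rintro ⟨n, hn⟩
  obtain ⟨e, rfl⟩ : ∃ e, d = e + 1 := ⟨d - 1, by omega⟩
  obtain ⟨r, rfl⟩ := Nat.exists_eq_add_of_le hN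
  have heq : (2 : ℤ) ^ (e + 1) * n - 2 ^ e = -2 ^ (e + 1 + r) :=
    (interlinkIndex_eq_even_iff (by omega) hk).1 hn
  have hodd : 2 * (n : ℤ) - 1 = -(2 * 2 ^ r) := mul_left_cancel₀ (pow_ne_zero e two_ne_zero)
    (by linear_combination heq)
  omega

theorem infinite_compl_range_interlinkIndex_comp_shiftedDyadicTime {d : ℕ} (hd : 1 ≤ d) :
    (Set.range (interlinkIndex ∘ shiftedDyadicTime d))ᶜ.Infinite :=
  NonposInt.infinite_of_forall_exists_le fun m =>
    ⟨⟨2 * -((d + (m : ℤ).natAbs : ℕ) : ℤ), by omega⟩,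
      notMem_range_interlinkIndex_comp_shiftedDyadicTime hd (Nat.le_add_right _ _) rfl,
      Subtype.coe_le_coe.1 (by dsimp only; omega)⟩

end TimeChange

end Standardness

theorem mainTheorem10 {Ω : Type u} [MeasurableSpace Ω] (P : Measure Ω) [IsProbabilityMeasure P]
    (F : Standardness.NegFiltration P) (hF : Standardness.IsAtThreshold F)
    (G : Standardness.NegFiltration P)
    (hG : G = F.slow Standardness.interlinkTime Standardness.interlinkTime_strictMono
      Standardness.interlinkTime_zero)
    (d : ℕ) (hd : 1 ≤ d) :
    ¬ Standardness.IsStandard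
        (G.extract (Standardness.dyadicTime d) (Standardness.dyadicTime_strictMono d)) ∧
      Standardness.IsStandard
        (G.extract (Standardness.shiftedDyadicTime d)
          (Standardness.shiftedDyadicTime_strictMono d)) := by
  open Standardness in
  subst hG
  have hdyadic := interlinkIndex_mono.comp (dyadicTime_strictMono d).monotone
  have hshifted := interlinkIndex_mono.comp (shiftedDyadicTime_strictMono d).monotone
  constructor
  · intro hstandard
    refine hF.1 (.of_reindex hdyadic (2 * d + 2) (fun n => ?_) hstandard)
    refine mem_range_interlinkIndex_comp_dyadicTime ?_
    rw [NonposInt.coe_iterate_pred]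
    push_cast
    linarith [n.2]
  · exact hF.isStandard_reindex hshifted
      (exists_interlinkIndex_comp_le (shiftedDyadicTime_strictMono d))
      (infinite_compl_range_interlinkIndex_comp_shiftedDyadicTime hd)
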